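/- Let $G=(V,E)$ be a linear graph, i.e. a directed graph with $V=\mathbb N=\{1,2,\dots\}$ whose edge set consists of all pairs $(i,1)$ and $(i,i+1)$, $i\in\mathbb N$, together with some forward jumps $(i,j)$, $j>i+1$, only finitely many for each $i$. Let $\mathcal W:E\to(0,\infty)$. The weight of a path is the product of the weights of its edges. A simple $v$-cycle is a path of length $n\ge1$ from $v$ to $v$ that does not pass through $v$ in between; $q_v(n)$ is the sum of the weights of the simple $v$-cycles of length $n$, $\Phi_v(z)=\sum_{n\ge1}q_v(n)z^n$, and $R_v$ is the radius of convergence of $\Phi_v$. Assume that $(G,\mathcal W)$ is unstable positive: for some vertex $v$, $\Phi_v(R_v)=1$ and $\Phi_v'(R_v)=\sum_{n\ge1} n\,q_v(n)R_v^{n-1}<\infty$. For $m>n\ge1$ let $G_{n,m}$ be the smallest subgraph of $G$ containing all simple $1$-cycles of length at most $n$ and all simple $1$-cycles of length $m$. For a finite connected subgraph $H$ of $G$, a $\mathcal W$-equilibrium measure of $H$ is a shift-invariant probability measure $\mu$ carried by the two-sided infinite paths $\omega=(\omega_i)_{i\in\mathbb Z}$ in $H$ that maximizes $h(\mu)+\int\log\mathcal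 W(\omega_0,\omega_1)\,d\mu$ among all such measures, where $h(\mu)=\lim_n \frac1n H_\mu(\omega_0,\dots,\omega_{n-1})$ is the entropy of the shift. Then there is a strictly increasing sequence of positive integers $n_k$ such that the graphs $H_k=G_{n_k,n_{k+1}}$ are finite and connected, form an exhaustive sequence ($H_k\subset H_{k+1}$, and the vertex sets and edge sets of the $H_k$ have unions $V$ and $E$), and this sequence is irregular relative to $\mathcal W$: each $H_k$ has a unique $\mathcal W$-equilibrium measure $\mu_k$, and the measures $\mu_k$ tend to the zero measure, i.e. $\mu_k(C)\to0$ for every cylinder $C=\{\omega:\omega_a=w_0,\dots,\omega_{a+\ell}=w_\ell\}$, $\ell\ge0$. -/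

import Mathlib

open Filter Topology MeasureTheory
open scoped ENNReal NNReal

noncomputable section

namespace LoadedGraph

/-- A directed graph (without multiple edges) whose vertices lie in `V`, with vertex set `verts`
and edge set `{(u, v) | Adj u v}`. -/
@[ext]
structure DiGraph (V : Type*) where
  /-- the vertex set -/
  verts : Set V
  /-- `Adj u v` says that `(u, v)` is an edge, going from `u` to `v` -/
  Adj : V → V → Prop
  /-- initial vertices are vertices of the graph -/
  fst_mem : ∀ {u v : V}, Adj u v → u ∈ verts
  /-- terminal vertices are vertices of the graph -/
  snd_mem : ∀ {u v : V}, Adj u v → v ∈ verts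

namespace DiGraph

variable {V : Type*}

/-- `H` is a subgraph of `G`. -/
def IsSubgraph (H G : DiGraph V) : Prop :=
  H.verts ⊆ G.verts ∧ ∀ u v : V, H.Adj u v → G.Adj u v

/-- For all vertices `u`, `v` there is a path (of positive length) going from `u` to `v`. -/
def IsConnected (G : DiGraph V) : Prop :=
  ∀ u ∈ G.verts, ∀ v ∈ G.verts, Relation.TransGen G.Adj u v

/-- An exhaustive sequence of subgraphs of `G`. -/
def IsExhaustive (G : DiGraph V) (H : ℕ → DiGraph V) : Prop :=
  (∀ k, (H k).IsSubgraph (H (k + 1))) ∧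
    (⋃ k, (H k).verts) = G.verts ∧
    ∀ u v : V, (∃ k, (H k).Adj u v) ↔ G.Adj u v

/-- `p 0, …, p n` is a simple `v`-cycle of length `n ≥ 1` in `G`: a path from `v` to `v` that does
not pass through `v` in between. -/
def IsSimpleCycle (G : DiGraph V) (v : V) (n : ℕ) (p : Fin (n + 1) → V) : Prop :=
  1 ≤ n ∧ p 0 = v ∧ p (Fin.last n) = v ∧
    (∀ i : Fin n, G.Adj (p i.castSucc) (p i.succ)) ∧
    ∀ i : Fin (n + 1), i ≠ 0 → i ≠ Fin.last n → p i ≠ v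

/-- The weight of the path `p 0, …, p n`, the product of the weights of its edges. -/
def pathWeight (W : V → V → ℝ) {n : ℕ} (p : Fin (n + 1) → V) : ℝ :=
  ∏ i : Fin n, W (p i.castSucc) (p i.succ)

/-- `q_v(n)`: the sum of the weights of all simple `v`-cycles of length `n`. -/
def cycleSum (G : DiGraph V) (W : V → V → ℝ) (v : V) (n : ℕ) : ℝ≥0∞ :=
  ∑' p : {p : Fin (n + 1) → V // G.IsSimpleCycle v n p}, ENNReal.ofReal (pathWeight W p.1)

/-- The generating function `Φ(z) = ∑ q_v(n) zⁿ`, for `z ≥ 0`. -/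
def genFun (G : DiGraph V) (W : V → V → ℝ) (v : V) (z : ℝ≥0∞) : ℝ≥0∞ :=
  ∑' n : ℕ, G.cycleSum W v n * z ^ n

/-- The derivative `Φ'(z) = ∑ n q_v(n) zⁿ⁻¹` (at the radius of convergence: the left derivative,
finite or infinite). -/
def genFunDeriv (G : DiGraph V) (W : V → V → ℝ) (v : V) (z : ℝ≥0∞) : ℝ≥0∞ :=
  ∑' n : ℕ, (n : ℝ≥0∞) * G.cycleSum W v n * z ^ (n - 1)

/-- The radius of convergence `R_v` of `Φ`, a power series with nonnegative coefficients. -/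
def convRadius (G : DiGraph V) (W : V → V → ℝ) (v : V) : ℝ≥0∞ :=
  ⨆ (r : ℝ≥0) (_ : G.genFun W v r < ∞), (r : ℝ≥0∞)

/-- The loaded graph `(G, W)` is unstable positive. (The first equation forces `0 < R_v < ∞`.) -/
def IsUnstablePositive (G : DiGraph V) (W : V → V → ℝ) : Prop :=
  ∃ v ∈ G.verts, G.genFun W v (G.convRadius W v) = 1 ∧ G.genFunDeriv W v (G.convRadius W v) < ∞

/-- The graph generated by a family `Γ` of paths `⟨n, p⟩`, where `p 0, …, p n` are the vertices
of the path: the smallest graph containing all of them. -/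
def generated (Γ : Set (Σ n : ℕ, Fin (n + 1) → V)) : DiGraph V where
  verts := {u | ∃ γ ∈ Γ, ∃ i, γ.2 i = u}
  Adj u v := ∃ γ ∈ Γ, ∃ i : Fin γ.1, γ.2 i.castSucc = u ∧ γ.2 i.succ = v
  fst_mem := by
    rintro u v ⟨γ, hγ, i, h, -⟩
    exact ⟨γ, hγ, _, h⟩
  snd_mem := by
    rintro u v ⟨γ, hγ, i, -, h⟩
    exact ⟨γ, hγ, _, h⟩

/-- `G_{n,m}`: the subgraph of `G` generated by the simple `v`-cycles of length at most `n` and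
those of length `m`. -/
def cycleSubgraph (G : DiGraph V) (v : V) (n m : ℕ) : DiGraph V :=
  generated {γ | G.IsSimpleCycle v γ.1 γ.2 ∧ (γ.1 ≤ n ∨ γ.1 = m)}

/-- The two-sided infinite paths in `G`. -/
def pathSpace (G : DiGraph V) : Set (ℤ → V) :=
  {ω | ∀ i : ℤ, G.Adj (ω i) (ω (i + 1))}

end DiGraph

section Measures

variable {V : Type*}

/-- The shift on two-sided sequences. -/
def shift (ω : ℤ → V) : ℤ → V := fun i => ω (i + 1)

/-- The cylinder of all `ω` with `ω (a + i) = w i` for `0 ≤ i < n`. -/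
def cylinder {n : ℕ} (a : ℤ) (w : Fin n → V) : Set (ℤ → V) :=
  {ω | ∀ i : Fin n, ω (a + (i : ℕ)) = w i}

variable [MeasurableSpace V]

/-- The entropy of the distribution of `(ω 0, …, ω (n - 1))` under `μ`. -/
def blockEntropy (μ : Measure (ℤ → V)) (n : ℕ) : ℝ :=
  ∑' w : Fin n → V, Real.negMulLog (μ.real (cylinder 0 w))

/-- The entropy of the shift with respect to an invariant probability measure `μ` under which the
coordinates take finitely many values: `lim H(ω 0, …, ω (n - 1)) / n` (the limit exists by
subadditivity, so it is the upper limit). -/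
def entropy (μ : Measure (ℤ → V)) : ℝ :=
  limsup (fun n : ℕ => blockEntropy μ n / n) atTop

/-- The functional `μ ↦ h(μ) + ∫ log W(ω 0, ω 1) dμ` that equilibrium measures maximize. -/
def pressureFunctional (W : V → V → ℝ) (μ : Measure (ℤ → V)) : ℝ :=
  entropy μ + ∫ ω, Real.log (W (ω 0) (ω 1)) ∂μ

/-- The shift-invariant probability measures on the path space of `G`, regarded as measures on
the space of all sequences that are carried by the path space. -/
def invariantMeasures (G : DiGraph V) : Set (Measure (ℤ → V)) :=
  {μ | IsProbabilityMeasure μ ∧ μ.map shift = μ ∧ ∀ᵐ ω ∂μ, ω ∈ G.pathSpace}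

/-- `μ` is a `W`-equilibrium measure of the graph `G` (with finitely many vertices). -/
def IsEquilibriumMeasure (G : DiGraph V) (W : V → V → ℝ) (μ : Measure (ℤ → V)) : Prop :=
  μ ∈ invariantMeasures G ∧
    ∀ ν ∈ invariantMeasures G, pressureFunctional W ν ≤ pressureFunctional W μ

/-- Convergence of measures on the path space to the zero measure: the measure of every cylinder
(over a nonempty block of coordinates) tends to zero. -/
def TendstoZeroMeasure (μ : ℕ → Measure (ℤ → V)) : Prop :=
  ∀ (n : ℕ) (a : ℤ) (w : Fin (n + 1) → V), Tendsto (fun k => μ k (cylinder a w)) atTop (𝓝 0)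

/-- The sequence `H` of finite connected graphs, which is exhaustive in `G`, is irregular relative
to `W`: every `H k` has a unique equilibrium measure, and these measures tend to zero. -/
def IsIrregular (G : DiGraph V) (W : V → V → ℝ) (H : ℕ → DiGraph V) : Prop :=
  G.IsExhaustive H ∧ (∀ k, (H k).verts.Finite ∧ (H k).IsConnected) ∧
    ∃ μ : ℕ → Measure (ℤ → V),
      (∀ k, IsEquilibriumMeasure (H k) W (μ k) ∧
        ∀ ν, IsEquilibriumMeasure (H k) W ν → ν = μ k) ∧
      TendstoZeroMeasure μ

end Measures

/-- A linear graph on the set of positive integers: the edges are all `(i, 1)` and `(i, i + 1)`,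
and some forward jumps `(i, j)` with `j > i + 1`, finitely many out of each `i`. -/
structure IsLinear (G : DiGraph ℕ) : Prop where
  verts_eq : G.verts = {i | 1 ≤ i}
  adj_one : ∀ i, 1 ≤ i → G.Adj i 1
  adj_succ : ∀ i, 1 ≤ i → G.Adj i (i + 1)
  adj_cases : ∀ i j, G.Adj i j → j = 1 ∨ j = i + 1 ∨ i + 1 < j
  finite_jumps : ∀ i, {j | i + 1 < j ∧ G.Adj i j}.Finite

end LoadedGraph

end

/-! Write `q(l)` and `Φ` for the cycle sums and the generating function at the vertex 1. Comparing
superharmonic functions of the kernel `z W` carries criticality from the given vertex to 1: there is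
`R > 0` with `Φ(R) ≤ 1` and `Φ = ∞` beyond `R` (`exists_critical_point`).

For `H = G_{n,m}` let `Φ_H(r) = 1`. The numbers `q_H(l) r^l` are the distribution of the return time
to 1 under the equilibrium measure of `H`, so by Kac's formula the measure of the vertex 1 is `1 / ∑
l q_H(l) r^l`. It remains to make the mean return time large. Along a simple 1-cycle the vertices
increase until the return, and every vertex has finitely many successors. Hence, for given `L` and
all large `m`, the simple 1-cycles of `H` have length at most a bound `B n` or at least `L`
(`cycleSum_cycleSubgraph_eq_zero`). Those of length at most `B n` have total weight less than one at
`R`, because longer cycles exist as well, and so at most some `a < 1` at some `ρ > R`. Since `Φ`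
diverges between `R` and `ρ`, there are arbitrarily large `m` with `q(m) ρ^m ≥ 1`, which forces `r ≤
ρ`. So the cycles of length at least `L` carry mass at least `1 - a`, and the mean return time is at
least `L (1 - a)`, where `L` is chosen after `a` (`exists_long_cycles`).

The equilibrium measure comes from a positive column eigenvector `x`: for the stochastic matrix `P i
j = r W i j x j / x i`, the functions `log P` and `log W + log r` differ by a coboundary, and Gibbs'
inequality bounds the pressure by `-log r`, with equality only for the stationary Markov measure of
`P` (`exists_unique_equilibriumMeasure`). Column and row eigenvectors `X`, `Y` are hitting sums with
value one at 1, so the vertex 1 has measure `1 / ∑ Y X`, and `mul_tail_le_tsum` is the needed half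
of Kac's formula. Finally a vertex `u` has at most `u` times the measure of 1
(`measure_cylinder_le`), so all cylinders vanish in the limit. -/

namespace LoadedGraph

/-! ### Hitting sums and superharmonic functions of a nonnegative kernel -/

section Hitting

variable {V : Type*}

open Classical in
/-- The total weight of the paths of length `n` from a vertex to the set `T` that meet `T` only at
their end, where `φ` gives an additional weight to the end point. -/
noncomputable def hitTerm (k : V → V → ℝ≥0∞) (T : Set V) (φ : V → ℝ≥0∞) : ℕ → V → ℝ≥0∞
  | 0, j => if j ∈ T then φ j else 0
  | n + 1, j => if j ∈ T then 0 else ∑' l, k j l * hitTerm k T φ n l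

/-- The total weight of the paths from a vertex to `T` that meet `T` only at their end. -/
noncomputable def hitSum (k : V → V → ℝ≥0∞) (T : Set V) (φ : V → ℝ≥0∞) (j : V) : ℝ≥0∞ :=
  ∑' n, hitTerm k T φ n j

/-- The total weight of the simple `v`-cycles. -/
noncomputable def returnSum (k : V → V → ℝ≥0∞) (v : V) : ℝ≥0∞ :=
  ∑' l, k v l * hitSum k {v} 1 l

variable {k : V → V → ℝ≥0∞} {T : Set V} {φ : V → ℝ≥0∞}

lemma hitSum_of_mem {j : V} (hj : j ∈ T) : hitSum k T φ j = φ j := by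
  rw [hitSum, tsum_eq_single 0]
  · simp [hitTerm, hj]
  · rintro (_ | n) hn
    · exact absurd rfl hn
    · simp [hitTerm, hj]

lemma hitSum_of_notMem {j : V} (hj : j ∉ T) :
    hitSum k T φ j = ∑' l, k j l * hitSum k T φ l := by
  rw [hitSum, tsum_eq_zero_add' ENNReal.summable]
  simp only [hitTerm, hj, if_false, zero_add, hitSum, ← ENNReal.tsum_mul_left]
  exact ENNReal.tsum_comm

/-- Minimality of the hitting sum among supersolutions: stripping the first step of the paths turns
a truncation at `N + 1` into one at `N`, so induction applies. -/
lemma sum_hitTerm_le {f : V → ℝ≥0∞} (h₁ : ∀ j ∈ T, φ j ≤ f j)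
    (h₂ : ∀ j ∉ T, ∑' l, k j l * f l ≤ f j) (N : ℕ) (j : V) :
    ∑ n ∈ Finset.range N, hitTerm k T φ n j ≤ f j := by
  induction N generalizing j with
  | zero => simp
  | succ N ih =>
    rw [Finset.sum_range_succ']
    by_cases hj : j ∈ T
    · simpa [hitTerm, hj] using h₁ j hj
    · simp only [hitTerm, hj, if_false, add_zero]
      refine le_trans ?_ (h₂ j hj)
      rw [← Summable.tsum_finsetSum fun _ _ => ENNReal.summable]
      refine ENNReal.tsum_le_tsum fun l => ?_
      rw [← Finset.mul_sum]
      gcongr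
      exact ih l

lemma hitSum_le {f : V → ℝ≥0∞} (h₁ : ∀ j ∈ T, φ j ≤ f j)
    (h₂ : ∀ j ∉ T, ∑' l, k j l * f l ≤ f j) (j : V) : hitSum k T φ j ≤ f j :=
  ENNReal.summable.tsum_le_of_sum_range_le fun N => sum_hitTerm_le h₁ h₂ N j

lemma hitTerm_add (φ ψ : V → ℝ≥0∞) (n : ℕ) (j : V) :
    hitTerm k T (fun i => φ i + ψ i) n j = hitTerm k T φ n j + hitTerm k T ψ n j := by
  induction n generalizing j with
  | zero => by_cases hj : j ∈ T <;> simp [hitTerm, hj]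
  | succ n ih =>
    by_cases hj : j ∈ T
    · simp [hitTerm, hj]
    · simp [hitTerm, hj, ih, mul_add, ENNReal.tsum_add]

lemma hitTerm_mul (c : ℝ≥0∞) (φ : V → ℝ≥0∞) (n : ℕ) (j : V) :
    hitTerm k T (fun i => c * φ i) n j = c * hitTerm k T φ n j := by
  induction n generalizing j with
  | zero => by_cases hj : j ∈ T <;> simp [hitTerm, hj]
  | succ n ih =>
    by_cases hj : j ∈ T
    · simp [hitTerm, hj]
    · simp [hitTerm, hj, ih, ← ENNReal.tsum_mul_left, mul_left_comm]

lemma hitSum_add (φ ψ : V → ℝ≥0∞) (j : V) :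
    hitSum k T (fun i => φ i + ψ i) j = hitSum k T φ j + hitSum k T ψ j := by
  simp [hitSum, hitTerm_add, ENNReal.tsum_add]

lemma hitSum_mul (c : ℝ≥0∞) (φ : V → ℝ≥0∞) (j : V) :
    hitSum k T (fun i => c * φ i) j = c * hitSum k T φ j := by
  simp [hitSum, hitTerm_mul, ENNReal.tsum_mul_left]

lemma hitTerm_mono {k' : V → V → ℝ≥0∞} (hk : ∀ i j, k i j ≤ k' i j) (n : ℕ) (j : V) :
    hitTerm k T φ n j ≤ hitTerm k' T φ n j := by
  induction n generalizing j with
  | zero => rfl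
  | succ n ih =>
    by_cases hj : j ∈ T
    · simp [hitTerm, hj]
    · simp only [hitTerm, hj, if_false]
      exact ENNReal.tsum_le_tsum fun l => mul_le_mul' (hk _ _) (ih l)

lemma hitSum_mono {k' : V → V → ℝ≥0∞} (hk : ∀ i j, k i j ≤ k' i j) (j : V) :
    hitSum k T φ j ≤ hitSum k' T φ j :=
  ENNReal.tsum_le_tsum fun n => hitTerm_mono hk n j

lemma hitTerm_scale (z : ℝ≥0∞) (n : ℕ) (j : V) :
    hitTerm (fun i j => z * k i j) T φ n j = z ^ n * hitTerm k T φ n j := by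
  induction n generalizing j with
  | zero => simp [hitTerm]
  | succ n ih =>
    by_cases hj : j ∈ T
    · simp [hitTerm, hj]
    · simp only [hitTerm, hj, if_false, ih, ← ENNReal.tsum_mul_left]
      refine tsum_congr fun l => ?_
      ring

/-- A positive superharmonic function bounds the weight of the simple cycles by one. -/
lemma returnSum_le_one {f : V → ℝ≥0∞} (hf : ∀ j, ∑' l, k j l * f l ≤ f j) {u : V}
    (h0 : f u ≠ 0) (htop : f u ≠ ∞) : returnSum k u ≤ 1 := by
  have key : ∀ j, hitSum k {u} 1 j ≤ (f u)⁻¹ * f j := by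
    refine hitSum_le ?_ ?_
    · rintro j rfl
      simp [ENNReal.inv_mul_cancel h0 htop]
    · intro j _
      calc ∑' l, k j l * ((f u)⁻¹ * f l) = (f u)⁻¹ * ∑' l, k j l * f l := by
            rw [← ENNReal.tsum_mul_left]
            exact tsum_congr fun l => by ring
        _ ≤ _ := by gcongr; exact hf j
  calc returnSum k u ≤ ∑' l, k u l * ((f u)⁻¹ * f l) :=
        ENNReal.tsum_le_tsum fun l => by gcongr; exact key l
    _ = (f u)⁻¹ * ∑' l, k u l * f l := by
        rw [← ENNReal.tsum_mul_left]
        exact tsum_congr fun l => by ring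
    _ ≤ (f u)⁻¹ * f u := by gcongr; exact hf u
    _ = 1 := ENNReal.inv_mul_cancel h0 htop

/-- Equality holds off `v` by the first-step equation; at `v` the left side is the total weight of
the simple cycles and the right side is one. -/
lemma hitSum_superharmonic {v : V} (hv : returnSum k v ≤ 1) (j : V) :
    ∑' l, k j l * hitSum k {v} 1 l ≤ hitSum k {v} 1 j := by
  by_cases hj : j = v
  · subst hj
    rw [hitSum_of_mem (Set.mem_singleton j)]
    exact hv
  · rw [hitSum_of_notMem (j := j) (by simpa using hj)]

end Hitting

/-! ### Generating functions of simple cycles as return sums -/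

namespace DiGraph

variable {V : Type*}

open Classical in
/-- The weight of an edge, extended by zero to all pairs of vertices. -/
noncomputable def edgeWeight (G : DiGraph V) (W : V → V → ℝ) (i j : V) : ℝ≥0∞ :=
  if G.Adj i j then ENNReal.ofReal (W i j) else 0

/-- The product of the weights of the edges along a sequence of vertices. -/
noncomputable def blockWeight (k : V → V → ℝ≥0∞) {n : ℕ} (p : Fin (n + 1) → V) : ℝ≥0∞ :=
  ∏ i : Fin n, k (p i.castSucc) (p i.succ)

lemma blockWeight_cons (k : V → V → ℝ≥0∞) {n : ℕ} (j : V) (p : Fin (n + 1) → V) :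
    blockWeight k (Fin.cons j p : Fin (n + 2) → V) = k j (p 0) * blockWeight k p := by
  simp [blockWeight, Fin.prod_univ_succ]

lemma tsum_fin_succ (n : ℕ) (f : (Fin (n + 1) → V) → ℝ≥0∞) :
    ∑' p, f p = ∑' j : V, ∑' t : Fin n → V, f (Fin.cons j t) := by
  rw [← ENNReal.tsum_prod, ← (Fin.consEquiv fun _ : Fin (n + 1) => V).tsum_eq]
  rfl

-- The condition says that `v` is met exactly at the last index. Being an edge need not be required,
-- since `k` may vanish.
open Classical in
lemma hitTerm_eq_tsum (k : V → V → ℝ≥0∞) (v : V) (n : ℕ) (j : V) :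
    hitTerm k {v} 1 n j = ∑' t : Fin n → V,
      if ∀ i : Fin (n + 1), (Fin.cons j t : Fin (n + 1) → V) i = v ↔ i = Fin.last n then
        blockWeight k (Fin.cons j t) else 0 := by
  induction n generalizing j with
  | zero =>
    rw [tsum_eq_single default (fun b hb => absurd (Subsingleton.elim _ _) hb)]
    simp [hitTerm, blockWeight, Fin.forall_fin_one]
  | succ n ih =>
    rw [tsum_fin_succ]
    by_cases hj : j = v
    · have : ∀ t : Fin (n + 1) → V,
        ¬ ∀ i : Fin (n + 2), (Fin.cons j t : Fin (n + 2) → V) i = v ↔ i = Fin.last (n + 1) := by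
        intro t h
        have := (h 0).1 (by simpa using hj)
        exact absurd this (by simp [Fin.ext_iff])
      rw [hitTerm, if_pos (by simpa using hj)]
      symm
      simp only [ENNReal.tsum_eq_zero]
      exact fun l t => if_neg (this _)
    · simp only [hitTerm, Set.mem_singleton_iff, hj, if_false, ih, ← ENNReal.tsum_mul_left]
      refine tsum_congr fun l => tsum_congr fun t => ?_
      rw [blockWeight_cons, mul_ite, mul_zero]
      simp only [Fin.cons_zero]
      congr 1
      rw [Fin.forall_fin_succ (n := n + 1)]
      simp [hj, Fin.ext_iff, -Fin.val_last]
      simp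

lemma cycleSum_zero (G : DiGraph V) (W : V → V → ℝ) (v : V) : G.cycleSum W v 0 = 0 := by
  have : IsEmpty {p : Fin (0 + 1) → V // G.IsSimpleCycle v 0 p} :=
    ⟨fun p => absurd p.2.1 (by norm_num)⟩
  simp [cycleSum]

lemma ofReal_pathWeight {G : DiGraph V} {W : V → V → ℝ} (hW : ∀ i j, G.Adj i j → 0 < W i j)
    {n : ℕ} (p : Fin (n + 1) → V) (hp : ∀ i : Fin n, G.Adj (p i.castSucc) (p i.succ)) :
    ENNReal.ofReal (pathWeight W p) = blockWeight (G.edgeWeight W) p := by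
  rw [pathWeight, ENNReal.ofReal_prod_of_nonneg fun i _ => (hW _ _ (hp i)).le]
  exact Finset.prod_congr rfl fun i _ => by simp [edgeWeight, hp i]

lemma blockWeight_eq_zero {G : DiGraph V} {W : V → V → ℝ}
    {n : ℕ} (p : Fin (n + 1) → V) (hp : ¬ ∀ i : Fin n, G.Adj (p i.castSucc) (p i.succ)) :
    blockWeight (G.edgeWeight W) p = 0 := by
  push Not at hp
  obtain ⟨i, hi⟩ := hp
  exact Finset.prod_eq_zero (Finset.mem_univ i) (by simp [edgeWeight, hi])

-- The first edge of a simple cycle is split off; the rest is a path that meets `v` only at its end.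
-- Sequences that are not paths contribute zero through `edgeWeight`.
open Classical in
lemma cycleSum_succ {G : DiGraph V} {W : V → V → ℝ} (hW : ∀ i j, G.Adj i j → 0 < W i j)
    (v : V) (n : ℕ) :
    G.cycleSum W v (n + 1) =
      ∑' l, G.edgeWeight W v l * hitTerm (G.edgeWeight W) {v} 1 n l := by
  have h1 : G.cycleSum W v (n + 1) = ∑' p : Fin (n + 2) → V,
      if p 0 = v ∧ ∀ i : Fin (n + 1), p i.succ = v ↔ i = Fin.last n then
        blockWeight (G.edgeWeight W) p else 0 := by
    have := tsum_subtype {p : Fin (n + 1 + 1) → V | G.IsSimpleCycle v (n + 1) p}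
      (fun p => ENNReal.ofReal (pathWeight W p))
    rw [cycleSum]
    refine this.trans (tsum_congr fun p => ?_)
    rw [Set.indicator_apply]
    have hiff : (p (Fin.last (n + 1)) = v ∧
        ∀ i : Fin (n + 2), i ≠ 0 → i ≠ Fin.last (n + 1) → p i ≠ v) ↔
        ∀ i : Fin (n + 1), p i.succ = v ↔ i = Fin.last n := by
      constructor
      · rintro ⟨h1, h2⟩ i
        refine ⟨fun h => ?_, ?_⟩
        · by_contra hi
          exact h2 i.succ (Fin.succ_ne_zero i)
            (fun h => hi (Fin.succ_injective _ (h.trans (Fin.succ_last n).symm))) h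
        · rintro rfl
          rwa [Fin.succ_last]
      · intro h
        refine ⟨by rw [← Fin.succ_last]; exact (h _).2 rfl, fun i h0 hl hv => ?_⟩
        obtain ⟨i, rfl⟩ := Fin.exists_succ_eq.2 h0
        exact hl (by rw [(h i).1 hv, Fin.succ_last])
    by_cases hp : ∀ i : Fin (n + 1), G.Adj (p i.castSucc) (p i.succ)
    · rw [ofReal_pathWeight hW p hp]
      refine if_congr ?_ rfl rfl
      rw [← hiff]
      simp only [Set.mem_ofPred_eq, IsSimpleCycle]
      have : 1 ≤ n + 1 := by omega
      tauto
    · rw [blockWeight_eq_zero p hp, ite_self, if_neg]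
      exact fun h => hp h.2.2.2.1
  rw [h1, tsum_fin_succ, tsum_eq_single v]
  · rw [tsum_fin_succ]
    refine tsum_congr fun l => ?_
    rw [hitTerm_eq_tsum, ← ENNReal.tsum_mul_left]
    refine tsum_congr fun t => ?_
    rw [blockWeight_cons, mul_ite, mul_zero]
    simp
  · intro j hj
    simp [hj]

/-- A path of length `n` collects `z ^ n` when each edge carries a factor `z`, so evaluating the
power series amounts to rescaling the kernel. -/
lemma genFun_eq_returnSum {G : DiGraph V} {W : V → V → ℝ} (hW : ∀ i j, G.Adj i j → 0 < W i j)
    (v : V) (z : ℝ≥0∞) :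
    G.genFun W v z = returnSum (fun i j => z * G.edgeWeight W i j) v := by
  rw [genFun, tsum_eq_zero_add' ENNReal.summable, cycleSum_zero, zero_mul, zero_add, returnSum]
  simp only [hitSum, ← ENNReal.tsum_mul_left]
  rw [ENNReal.tsum_comm]
  refine tsum_congr fun n => ?_
  rw [cycleSum_succ hW, ← ENNReal.tsum_mul_right]
  refine tsum_congr fun l => ?_
  rw [hitTerm_scale]
  ring

end DiGraph

/-! ### Comparison of the return sums at two vertices -/

section Transfer

variable {k : ℕ → ℕ → ℝ≥0∞}

lemma ne_zero_of_succ_step {f : ℕ → ℝ≥0∞} {a v : ℕ} (hk : ∀ i, a ≤ i → k i (i + 1) ≠ 0)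
    (hf : ∀ i, a ≤ i → i < v → k i (i + 1) * f (i + 1) ≤ f i) (hv : f v ≠ 0)
    {i : ℕ} (hai : a ≤ i) (hiv : i ≤ v) : f i ≠ 0 := by
  induction hiv using Nat.decreasingInduction with
  | self => exact hv
  | of_succ i hi ih =>
    intro h0
    have := hf i hai hi
    rw [h0, nonpos_iff_eq_zero, mul_eq_zero] at this
    exact this.elim (hk i hai) (ih (by omega))

lemma ne_top_of_mul_le {a b c : ℝ≥0∞} (ha : a ≠ 0) (hc : c ≠ ∞) (h : a * b ≤ c) : b ≠ ∞ := by
  rintro rfl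
  rw [ENNReal.mul_top ha, top_le_iff] at h
  exact hc h

/-- The weight of reaching `v` is superharmonic, so `returnSum_le_one` applies to it at the vertex
1. It is positive there because of the path `1 → 2 → ⋯ → v`, and finite because of the edge `v → 1`.
-/
lemma returnSum_one_le_one (h₁ : ∀ i, 1 ≤ i → k i 1 ≠ 0) (hs : ∀ i, 1 ≤ i → k i (i + 1) ≠ 0)
    {v : ℕ} (hv : 1 ≤ v) (h : returnSum k v ≤ 1) : returnSum k 1 ≤ 1 := by
  have hf := hitSum_superharmonic h
  have hfv : hitSum k {v} 1 v = 1 := hitSum_of_mem (Set.mem_singleton v)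
  refine returnSum_le_one hf (u := 1) ?_ ?_
  · refine ne_zero_of_succ_step (a := 1) (v := v) hs (fun i _ _ => ?_) ?_ le_rfl hv
    · exact (ENNReal.le_tsum (i + 1)).trans (hf i)
    · simp [hfv]
  · exact ne_top_of_mul_le (h₁ v hv) (hfv ▸ ENNReal.one_ne_top)
      ((ENNReal.le_tsum 1).trans (hf v))

/-- If the simple `1`-cycles have finite total weight, and the additional weight of those that pass
through `v` exceeds the excess of the total weight over one, then the simple `v`-cycles have finite
total weight. -/
lemma returnSum_ne_top {v : ℕ} (hv : 2 ≤ v) (h₁ : ∀ i, 1 ≤ i → k i 1 ≠ 0)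
    (hs : ∀ i, 1 ≤ i → k i (i + 1) ≠ 0) (hfin : returnSum k 1 ≠ ∞) {c : ℝ≥0∞}
    (hlt : returnSum k 1 < 1 + c)
    (hle : c ≤ hitSum k {1} 1 v * ∑' j, k 1 j * hitSum k {1, v} (fun i => if i = v then 1 else 0) j) :
    returnSum k v ≠ ∞ := by
  have hv1 : v ≠ 1 := by omega
  set g := hitSum k {1} 1 with hg
  set T : Set ℕ := {1, v} with hT
  set δ₁ : ℕ → ℝ≥0∞ := fun i => if i = 1 then 1 else 0 with hδ₁
  set δ : ℕ → ℝ≥0∞ := fun i => if i = v then 1 else 0 with hδ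
  set a := ∑' j, k 1 j * hitSum k T δ j with ha
  set b := ∑' j, k 1 j * hitSum k T δ₁ j with hb
  have g1 : g 1 = 1 := hitSum_of_mem (Set.mem_singleton 1)
  have gharm : ∀ j, j ≠ 1 → g j = ∑' l, k j l * g l := fun j hj => hitSum_of_notMem (by simpa using hj)
  have gv0 : g v ≠ 0 := by
    intro h0
    have h2 : k v 1 * g 1 ≤ g v := (ENNReal.le_tsum 1).trans (gharm v hv1).ge
    rw [h0, g1, mul_one, nonpos_iff_eq_zero] at h2
    exact h₁ v (by omega) h2
  have gtop : ∀ i, 1 ≤ i → g i ≠ ∞ := by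
    intro i hi
    induction i, hi using Nat.le_induction with
    | base => simp [g1]
    | succ i hi ih =>
      rcases eq_or_lt_of_le hi with rfl | hi'
      · exact ne_top_of_mul_le (hs 1 le_rfl) hfin (ENNReal.le_tsum (1 + 1))
      · exact ne_top_of_mul_le (hs i hi) ih
          ((ENNReal.le_tsum (i + 1)).trans (gharm i (by omega)).ge)
  -- The simple 1-cycles split into those avoiding `v`, of weight `b`, and those through `v`: weight
  -- `a` up to the first visit, then `g v` back to 1. Hence `b < 1`.
  have hdec : b + g v * a ≤ returnSum k 1 := by
    have : ∀ j, hitSum k T δ₁ j + g v * hitSum k T δ j ≤ g j := by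
      intro j
      rw [← hitSum_mul, ← hitSum_add]
      refine hitSum_le ?_ ?_ j
      · rintro j (rfl | rfl)
        · simp [hδ₁, hδ, g1, hv1.symm]
        · simp [hδ₁, hδ, hv1]
      · intro j hj
        rw [hT, Set.mem_insert_iff, not_or] at hj
        exact (gharm j hj.1).ge
    rw [hb, ha, ← ENNReal.tsum_mul_left, ← ENNReal.tsum_add]
    refine ENNReal.tsum_le_tsum fun j => ?_
    calc k 1 j * hitSum k T δ₁ j + g v * (k 1 j * hitSum k T δ j)
        = k 1 j * (hitSum k T δ₁ j + g v * hitSum k T δ j) := by ring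
      _ ≤ _ := by gcongr; exact this j
  have hb1 : b < 1 := by
    have : b + c < 1 + c := lt_of_le_of_lt (by gcongr) (lt_of_le_of_lt hdec hlt)
    exact lt_of_add_lt_add_right this
  have hatop : a ≠ ∞ := ne_top_of_mul_le gv0 hfin (le_add_self.trans hdec)
  have hb' : 1 - b ≠ 0 := (tsub_pos_of_lt hb1).ne'
  -- The weight of all paths from 1 that end at their first visit to `v`: a geometric series over
  -- the preceding excursions from 1 that avoid `v`.
  set s := a / (1 - b) with hs'
  have hs_fin : s ≠ ∞ := ENNReal.div_ne_top hatop hb'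
  have hsb : s * b + a = s := by
    have h1 : s * (1 - b) = a := ENNReal.div_mul_cancel hb' (by finiteness)
    calc s * b + a = s * (b + (1 - b)) := by rw [mul_add, h1]
      _ = s := by rw [add_tsub_cancel_of_le hb1.le, mul_one]
  set f := hitSum k T (fun i => s * δ₁ i + δ i) with hf
  have hf1 : f 1 = s := by
    rw [hf, hitSum_of_mem (by simp [hT])]
    simp [hδ₁, hδ, hv1.symm]
  have hEf : ∀ j, hitSum k {v} 1 j ≤ f j := by
    refine hitSum_le ?_ ?_
    · rintro j rfl
      rw [hf, hitSum_of_mem (by simp [hT])]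
      simp [hδ₁, hδ, hv1]
    · intro j hj
      by_cases hj1 : j = 1
      · subst hj1
        rw [hf1, ← hsb, ha, hb, ← ENNReal.tsum_mul_left, ← ENNReal.tsum_add]
        refine ENNReal.tsum_le_tsum fun j => ?_
        rw [hf, hitSum_add, hitSum_mul]
        exact le_of_eq (by ring)
      · rw [hf, hitSum_of_notMem (j := j)]
        rw [hT, Set.mem_insert_iff, not_or]
        exact ⟨hj1, hj⟩
  -- The constant dominates the boundary values: `s` at the vertex 1, where `g` is one, and one at
  -- `v`.
  have hfg : ∀ j, f j ≤ (s + (g v)⁻¹) * g j := by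
    refine hitSum_le ?_ ?_
    · rintro j (rfl | rfl)
      · simp [hδ₁, hδ, g1, hv1.symm]
      · simp only [hδ₁, hδ, hv1, if_true, if_false, mul_zero, zero_add, add_mul]
        rw [ENNReal.inv_mul_cancel gv0 (gtop _ (by omega))]
        exact le_add_self
    · intro j hj
      rw [hT, Set.mem_insert_iff, not_or] at hj
      rw [gharm j hj.1, ← ENNReal.tsum_mul_left]
      exact ENNReal.tsum_le_tsum fun l => le_of_eq (by ring)
  have hfinal : returnSum k v ≤ (s + (g v)⁻¹) * g v := by
    generalize (s + (g v)⁻¹) = C at hfg ⊢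
    rw [gharm v hv1, ← ENNReal.tsum_mul_left, returnSum]
    refine ENNReal.tsum_le_tsum fun l => ?_
    calc k v l * hitSum k {v} 1 l ≤ k v l * (C * g l) := by
          gcongr
          exact (hEf l).trans (hfg l)
      _ = _ := by ring
  refine ne_top_of_le_ne_top ?_ hfinal
  exact ENNReal.mul_ne_top (ENNReal.add_ne_top.2 ⟨hs_fin, ENNReal.inv_ne_top.2 gv0⟩)
    (gtop v (by omega))

end Transfer

/-! ### Convexity of power series with nonnegative coefficients -/

section Convexity

lemma pow_convex_comb_le {s t x y : ℝ≥0∞} (hst : s + t = 1) (n : ℕ) :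
    (s * x + t * y) ^ n ≤ s * x ^ n + t * y ^ n := by
  rcases Nat.eq_zero_or_pos n with rfl | hn
  · simp [hst]
  · have := ENNReal.rpow_arith_mean_le_arith_mean2_rpow s t x y hst (p := n) (by exact_mod_cast hn)
    simpa [ENNReal.rpow_natCast] using this

/-- A power series with nonnegative coefficients that converges at `y` is upper semicontinuous from
the right at `x < y`. -/
lemma exists_gt_powerSeries_lt {q : ℕ → ℝ≥0∞} {x y : ℝ≥0} (hxy : x < y)
    (hx : ∑' n, q n * (x : ℝ≥0∞) ^ n ≤ 1) (hy : ∑' n, q n * (y : ℝ≥0∞) ^ n ≠ ∞) {c : ℝ≥0∞}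
    (hc : c ≠ 0) : ∃ z : ℝ≥0, x < z ∧ z ≤ y ∧ ∑' n, q n * (z : ℝ≥0∞) ^ n < 1 + c := by
  -- The point sought is `(1 - t) x + t y`: by convexity the series there is at most `(1 - t)` times
  -- its value at `x` plus `t` times its value at `y`, and the last term is less than `c` for small
  -- `t`.
  obtain ⟨t, ht0, ht1, htc⟩ : ∃ t : ℝ≥0, t ≠ 0 ∧ t ≤ 1 ∧
      (t : ℝ≥0∞) * ∑' n, q n * (y : ℝ≥0∞) ^ n < c := by
    have hlim : Tendsto (fun t : ℝ≥0 => (t : ℝ≥0∞) * ∑' n, q n * (y : ℝ≥0∞) ^ n) (𝓝[>] 0)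
        (𝓝 (((0 : ℝ≥0) : ℝ≥0∞) * ∑' n, q n * (y : ℝ≥0∞) ^ n)) := by
      refine ENNReal.Tendsto.mul_const ?_ (Or.inr hy)
      exact (ENNReal.tendsto_coe.2 tendsto_id).mono_left nhdsWithin_le_nhds
    rw [ENNReal.coe_zero, zero_mul] at hlim
    have h1 := hlim.eventually_lt_const (pos_iff_ne_zero.2 hc)
    have h2 : ∀ᶠ t : ℝ≥0 in 𝓝[>] 0, t ∈ Set.Ioc (0 : ℝ≥0) 1 := Ioc_mem_nhdsGT zero_lt_one
    obtain ⟨t, ht, ht'⟩ := (h1.and h2).exists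
    exact ⟨t, ht'.1.ne', ht'.2, ht⟩
  have hst : ((1 - t : ℝ≥0) : ℝ≥0∞) + t = 1 := by
    rw [← ENNReal.coe_add, tsub_add_cancel_of_le ht1, ENNReal.coe_one]
  have hst' : (1 - t) + t = 1 := tsub_add_cancel_of_le ht1
  refine ⟨(1 - t) * x + t * y, ?_, ?_, ?_⟩
  · calc x = (1 - t) * x + t * x := by rw [← add_mul, hst', one_mul]
      _ < (1 - t) * x + t * y := by
        gcongr
  · calc (1 - t) * x + t * y ≤ (1 - t) * y + t * y := by gcongr
      _ = y := by rw [← add_mul, hst', one_mul]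
  · push_cast [-ENNReal.coe_sub]
    calc ∑' n, q n * (((1 - t : ℝ≥0) : ℝ≥0∞) * x + t * y) ^ n
        ≤ ∑' n, (((1 - t : ℝ≥0) : ℝ≥0∞) * (q n * (x : ℝ≥0∞) ^ n) + t * (q n * (y : ℝ≥0∞) ^ n)) := by
          refine ENNReal.tsum_le_tsum fun n => ?_
          calc _ ≤ q n * (((1 - t : ℝ≥0) : ℝ≥0∞) * (x : ℝ≥0∞) ^ n + t * (y : ℝ≥0∞) ^ n) := by
                gcongr
                exact pow_convex_comb_le hst n
            _ = _ := by ring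
      _ = ((1 - t : ℝ≥0) : ℝ≥0∞) * ∑' n, q n * (x : ℝ≥0∞) ^ n
          + t * ∑' n, q n * (y : ℝ≥0∞) ^ n := by
          rw [ENNReal.tsum_add, ENNReal.tsum_mul_left, ENNReal.tsum_mul_left]
      _ < 1 + c := by
          refine ENNReal.add_lt_add_of_le_of_lt ?_ ?_ htc
          · exact ne_top_of_le_ne_top ENNReal.one_ne_top
              (mul_le_one' (by exact_mod_cast tsub_le_self) hx)
          · exact mul_le_one' (by exact_mod_cast tsub_le_self) hx

end Convexity

/-! ### The critical point of the generating function at the vertex 1 -/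

namespace IsLinear

variable {G : DiGraph ℕ} {W : ℕ → ℕ → ℝ}

lemma edgeWeight_one_ne_zero (hG : IsLinear G) (hW : ∀ i j, G.Adj i j → 0 < W i j) {z : ℝ≥0∞}
    (hz : z ≠ 0) (i : ℕ) (hi : 1 ≤ i) : z * G.edgeWeight W i 1 ≠ 0 := by
  simp [DiGraph.edgeWeight, hG.adj_one i hi, hz, hW i 1 (hG.adj_one i hi)]

lemma edgeWeight_succ_ne_zero (hG : IsLinear G) (hW : ∀ i j, G.Adj i j → 0 < W i j) {z : ℝ≥0∞}
    (hz : z ≠ 0) (i : ℕ) (hi : 1 ≤ i) : z * G.edgeWeight W i (i + 1) ≠ 0 := by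
  simp [DiGraph.edgeWeight, hG.adj_succ i hi, hz, hW i _ (hG.adj_succ i hi)]

/-- Divergence of the generating function beyond `R` passes from any vertex to the vertex `1`. -/
lemma genFun_one_eq_top (hG : IsLinear G) (hW : ∀ i j, G.Adj i j → 0 < W i j) {v : ℕ}
    (hv : 1 ≤ v) {R : ℝ≥0} (hR : R ≠ 0) (h1 : G.genFun W 1 R ≤ 1)
    (hdiv : ∀ z : ℝ≥0, R < z → G.genFun W v z = ∞) (z : ℝ≥0) (hz : R < z) :
    G.genFun W 1 z = ∞ := by
  rcases eq_or_lt_of_le hv with rfl | hv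
  · exact hdiv z hz
  by_contra hfin
  set k : ℝ≥0 → ℕ → ℕ → ℝ≥0∞ := fun z i j => z * G.edgeWeight W i j with hk
  have hmono : ∀ {x y : ℝ≥0}, x ≤ y → ∀ i j, k x i j ≤ k y i j := by
    intro x y hxy i j
    simp only [hk]
    gcongr
  -- The weight at `x` of the simple 1-cycles through `v`, split at the first visit to `v`. It is
  -- increasing in `x` and positive at `R`. If `Φ_1` were finite at `z`, it would exceed one by less
  -- than `c R` at some `y > R`, and then `Φ_v` would be finite at `y`.
  set c : ℝ≥0 → ℝ≥0∞ := fun x => hitSum (k x) {1} 1 v *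
    ∑' j, k x 1 j * hitSum (k x) {1, v} (fun i => if i = v then 1 else 0) j with hc
  have hcm : ∀ {x y : ℝ≥0}, x ≤ y → c x ≤ c y := by
    intro x y hxy
    refine mul_le_mul' (hitSum_mono (hmono hxy) v) (ENNReal.tsum_le_tsum fun j => ?_)
    exact mul_le_mul' (hmono hxy _ _) (hitSum_mono (hmono hxy) j)
  have hR' : (R : ℝ≥0∞) ≠ 0 := by simpa using hR
  have hc0 : c R ≠ 0 := by
    have hv1 : v ≠ 1 := by omega
    refine mul_ne_zero ?_ ?_
    · rw [hitSum_of_notMem (by simpa using hv1)]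
      refine ne_of_gt (lt_of_lt_of_le ?_ (ENNReal.le_tsum 1))
      rw [hitSum_of_mem (Set.mem_singleton 1), Pi.one_apply, mul_one]
      exact pos_iff_ne_zero.2 (hG.edgeWeight_one_ne_zero hW hR' v (by omega))
    · refine ne_of_gt (lt_of_lt_of_le ?_ (ENNReal.le_tsum 2))
      refine pos_iff_ne_zero.2 (mul_ne_zero (hG.edgeWeight_succ_ne_zero hW hR' 1 le_rfl) ?_)
      refine ne_zero_of_succ_step (k := k R) (a := 2) (v := v)
        (fun i hi => hG.edgeWeight_succ_ne_zero hW hR' i (by omega)) (fun i hi hiv => ?_) ?_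
        le_rfl hv
      · rw [hitSum_of_notMem (j := i)]
        · exact ENNReal.le_tsum (i + 1)
        · simp only [Set.mem_insert_iff, Set.mem_singleton_iff]
          omega
      · rw [hitSum_of_mem (by simp)]
        simp
  obtain ⟨e, he0, hee⟩ := ENNReal.lt_iff_exists_nnreal_btwn.1 (pos_iff_ne_zero.2 hc0)
  have he0' : (e : ℝ≥0∞) ≠ 0 := by simpa using (show e ≠ 0 from fun h => by simp [h] at he0)
  obtain ⟨y, hRy, hyz, hy⟩ := exists_gt_powerSeries_lt hz h1 hfin he0'
  have hlt : returnSum (k y) 1 < 1 + e := by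
    have := DiGraph.genFun_eq_returnSum hW 1 (y : ℝ≥0∞)
    rw [DiGraph.genFun] at this
    rwa [this] at hy
  have hy0 : (y : ℝ≥0∞) ≠ 0 := by
    simpa using (lt_of_le_of_lt zero_le hRy).ne'
  have hne : returnSum (k y) v ≠ ∞ := by
    refine returnSum_ne_top hv (hG.edgeWeight_one_ne_zero hW hy0)
      (hG.edgeWeight_succ_ne_zero hW hy0) hlt.ne_top (c := e) hlt ?_
    exact hee.le.trans (hcm hRy.le)
  exact hne ((DiGraph.genFun_eq_returnSum hW v (y : ℝ≥0∞)).symm.trans (hdiv y hRy))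

/-- For an unstable positive linear graph, the generating function at the vertex `1` is at most one
at some positive point beyond which it diverges. -/
lemma exists_critical_point (hG : IsLinear G) (hW : ∀ i j, G.Adj i j → 0 < W i j)
    (hU : G.IsUnstablePositive W) :
    ∃ R : ℝ≥0, R ≠ 0 ∧ G.genFun W 1 R ≤ 1 ∧ ∀ z : ℝ≥0, R < z → G.genFun W 1 z = ∞ := by
  obtain ⟨v, hvG, h1, -⟩ := hU
  have hv : 1 ≤ v := by simpa [hG.verts_eq] using hvG
  -- At `z = ∞` every term is zero or infinite, so the sum cannot equal one.
  have htop : G.convRadius W v ≠ ∞ := by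
    intro h
    rw [h, DiGraph.genFun] at h1
    have hz : ∀ n, G.cycleSum W v n * ∞ ^ n = 0 := by
      intro n
      by_contra hn
      rcases Nat.eq_zero_or_pos n with rfl | hpos
      · simp [DiGraph.cycleSum_zero] at hn
      · have h2 : G.cycleSum W v n * ∞ ^ n = ∞ := by
          rw [ENNReal.top_pow hpos.ne'] at hn ⊢
          exact ENNReal.mul_top fun h0 => hn (by simp [h0])
        have := (ENNReal.le_tsum (f := fun n => G.cycleSum W v n * ∞ ^ n) n).trans h1.le
        rw [h2] at this
        exact absurd this (by simp)
    simp [hz] at h1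
  obtain ⟨R, hR⟩ := WithTop.ne_top_iff_exists.1 htop
  change (R : ℝ≥0∞) = _ at hR
  rw [← hR] at h1
  have hR0 : R ≠ 0 := by
    rintro rfl
    rw [DiGraph.genFun, tsum_eq_single 0] at h1
    · simp [DiGraph.cycleSum_zero] at h1
    · intro n hn
      simp [hn]
  have hR' : (R : ℝ≥0∞) ≠ 0 := by simpa using hR0
  have hle : G.genFun W 1 R ≤ 1 := by
    rw [DiGraph.genFun_eq_returnSum hW] at h1 ⊢
    exact returnSum_one_le_one (hG.edgeWeight_one_ne_zero hW hR')
      (hG.edgeWeight_succ_ne_zero hW hR') hv h1.le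
  refine ⟨R, hR0, hle, hG.genFun_one_eq_top hW hv hR0 hle fun z hz => ?_⟩
  by_contra hfin
  have : (z : ℝ≥0∞) ≤ G.convRadius W v :=
    le_iSup₂ (f := fun (r : ℝ≥0) (_ : G.genFun W v r < ∞) => (r : ℝ≥0∞)) z (lt_top_iff_ne_top.2 hfin)
  rw [← hR] at this
  exact absurd (by exact_mod_cast this) (not_le.2 hz)

end IsLinear

/-! ### Simple cycles of a linear graph and of its subgraphs -/

open DiGraph

lemma DiGraph.IsSimpleCycle.mono {V : Type*} {G H : DiGraph V} (h : ∀ u v, H.Adj u v → G.Adj u v)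
    {v : V} {n : ℕ} {p : Fin (n + 1) → V} (hp : H.IsSimpleCycle v n p) : G.IsSimpleCycle v n p :=
  ⟨hp.1, hp.2.1, hp.2.2.1, fun i => h _ _ (hp.2.2.2.1 i), hp.2.2.2.2⟩

lemma cycleSum_mono_of_imp {V : Type*} {G H : DiGraph V} {W : V → V → ℝ} {v : V} {n : ℕ}
    (h : ∀ p, H.IsSimpleCycle v n p → G.IsSimpleCycle v n p) :
    H.cycleSum W v n ≤ G.cycleSum W v n := by
  have h1 := tsum_subtype {p : Fin (n + 1) → V | H.IsSimpleCycle v n p}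
    (fun p => ENNReal.ofReal (pathWeight W p))
  have h2 := tsum_subtype {p : Fin (n + 1) → V | G.IsSimpleCycle v n p}
    (fun p => ENNReal.ofReal (pathWeight W p))
  refine h1.trans_le (le_of_le_of_eq ?_ h2.symm)
  exact ENNReal.tsum_le_tsum fun p => Set.indicator_le_indicator_of_subset h (fun _ => zero_le) p

lemma cycleSum_eq_zero {V : Type*} {G : DiGraph V} {W : V → V → ℝ} {v : V} {n : ℕ}
    (h : ∀ p, ¬ G.IsSimpleCycle v n p) : G.cycleSum W v n = 0 := by
  have : IsEmpty {p : Fin (n + 1) → V // G.IsSimpleCycle v n p} := ⟨fun p => h _ p.2⟩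
  simp [cycleSum]

namespace IsLinear

variable {G : DiGraph ℕ} {W : ℕ → ℕ → ℝ}

lemma one_le (hG : IsLinear G) {i j : ℕ} (h : G.Adj i j) : 1 ≤ i := by
  have := G.fst_mem h
  rwa [hG.verts_eq] at this

lemma lt_of_adj (hG : IsLinear G) {i j : ℕ} (h : G.Adj i j) (hj : j ≠ 1) : i < j := by
  rcases hG.adj_cases i j h with h | h | h <;> omega

/-- A simple 1-cycle starts at 1 and moves strictly upwards until it returns, so its position
exceeds the elapsed time. -/
lemma index_lt (hG : IsLinear G) {n : ℕ} {p : Fin (n + 1) → ℕ} (hp : G.IsSimpleCycle 1 n p)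
    (i : ℕ) (hi : i < n) : i < p ⟨i, by omega⟩ := by
  induction i with
  | zero =>
    have := hp.2.1
    change 0 < p 0
    omega
  | succ i ih =>
    have h1 := ih (by omega)
    have h2 := hp.2.2.2.1 ⟨i, by omega⟩
    have h3 := hp.2.2.2.2 ⟨i + 1, by omega⟩ (by simp [Fin.ext_iff]) (by simp [Fin.ext_iff]; omega)
    have h4 := hG.lt_of_adj h2 h3
    change p ⟨i, _⟩ < p ⟨i + 1, _⟩ at h4
    omega

/-- Only finitely many edges leave the vertices up to `b`, so one step leads from there to a bounded
set. `B` iterates this one-step bound starting from 1 and depends on the elapsed time, not on the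
length of the cycle. -/
lemma exists_reach_bound (hG : IsLinear G) :
    ∃ B : ℕ → ℕ, Monotone B ∧ ∀ (n : ℕ) (p : Fin (n + 1) → ℕ), G.IsSimpleCycle 1 n p →
      ∀ i : Fin (n + 1), p i ≤ B i := by
  have hstep : ∀ b : ℕ, ∃ b', b ≤ b' ∧ ∀ i ≤ b, ∀ j, G.Adj i j → j ≤ b' := by
    intro b
    have hfin : (⋃ i ∈ Set.Iic b, {j | i + 1 < j ∧ G.Adj i j}).Finite :=
      (Set.finite_Iic b).biUnion fun i _ => hG.finite_jumps i
    obtain ⟨c, hc⟩ := hfin.bddAbove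
    refine ⟨max c (b + 1), by omega, fun i hi j hij => ?_⟩
    rcases hG.adj_cases i j hij with h | h | h
    · omega
    · omega
    · have : j ≤ c := hc (Set.mem_biUnion (show i ∈ Set.Iic b from hi) ⟨h, hij⟩)
      omega
  choose f hf1 hf2 using hstep
  refine ⟨fun n => f^[n] 1, monotone_nat_of_le_succ fun n => ?_, fun n p hp i => ?_⟩
  · rw [Function.iterate_succ_apply']
    exact hf1 _
  · obtain ⟨i, hi⟩ := i
    induction i with
    | zero => exact hp.2.1.le
    | succ i ih =>
      change _ ≤ f^[i + 1] 1
      rw [Function.iterate_succ_apply']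
      exact hf2 _ _ (ih (by omega)) _ (hp.2.2.2.1 ⟨i, by omega⟩)

/-- The simple cycle `1 → 2 → ⋯ → n → j → 1`. -/
lemma isSimpleCycle_through (hG : IsLinear G) {n j : ℕ} (hn : 1 ≤ n) (hnj : G.Adj n j)
    (hj : j ≠ 1) :
    G.IsSimpleCycle 1 (n + 1)
      (fun i => if (i : ℕ) < n then i + 1 else if (i : ℕ) = n then j else 1) := by
  refine ⟨by omega, by simp; omega, by simp, fun i => ?_, fun i h0 hl => ?_⟩
  · obtain ⟨i, hi⟩ := i
    have hj1 : 1 ≤ j := by have := hG.lt_of_adj hnj hj; omega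
    simp only [Fin.val_castSucc, Fin.val_succ]
    split_ifs <;> try omega
    · exact hG.adj_succ _ (by omega)
    · have : i + 1 = n := by omega
      rwa [this]
    · exact hG.adj_one _ hj1
  · have h0' : (i : ℕ) ≠ 0 := fun h => h0 (Fin.ext h)
    have hl' : (i : ℕ) ≠ n + 1 := fun h => hl (Fin.ext h)
    have := i.2
    dsimp only
    split_ifs <;> omega

/-- The simple cycle `1 → 2 → ⋯ → n → 1`. -/
lemma isSimpleCycle_straight (hG : IsLinear G) {n : ℕ} (hn : 1 ≤ n) :
    G.IsSimpleCycle 1 n (fun i => if (i : ℕ) < n then i + 1 else 1) := by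
  refine ⟨hn, by simp, by simp, fun i => ?_, fun i h0 hl => ?_⟩
  · obtain ⟨i, hi⟩ := i
    simp only [Fin.val_castSucc, Fin.val_succ]
    split_ifs <;> try omega
    · exact hG.adj_succ _ (by omega)
    · exact hG.adj_one _ (by omega)
  · have h0' : (i : ℕ) ≠ 0 := fun h => h0 (Fin.ext h)
    have hl' : (i : ℕ) ≠ n := fun h => hl (Fin.ext h)
    have := i.2
    dsimp only
    split_ifs <;> omega

lemma cycleSum_ne_zero (hG : IsLinear G) (hW : ∀ i j, G.Adj i j → 0 < W i j) {n : ℕ}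
    (hn : 1 ≤ n) : G.cycleSum W 1 n ≠ 0 := by
  rw [cycleSum, Ne, ENNReal.tsum_eq_zero, not_forall]
  refine ⟨⟨_, hG.isSimpleCycle_straight hn⟩, ?_⟩
  rw [ENNReal.ofReal_eq_zero, not_le]
  exact Finset.prod_pos fun i _ => hW _ _ ((hG.isSimpleCycle_straight hn).2.2.2.1 i)

end IsLinear

section Subgraph

variable {G : DiGraph ℕ} {W : ℕ → ℕ → ℝ} {n m : ℕ}

lemma adj_of_cycleSubgraph {V : Type*} {G : DiGraph V} {v a b : V} {n m : ℕ}
    (h : (G.cycleSubgraph v n m).Adj a b) : G.Adj a b := by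
  obtain ⟨γ, hγ, i, rfl, rfl⟩ := h
  exact hγ.1.2.2.2.1 i

lemma isSimpleCycle_cycleSubgraph {V : Type*} {G : DiGraph V} {v : V} {n m l : ℕ}
    {p : Fin (l + 1) → V} (hp : G.IsSimpleCycle v l p) (hl : l ≤ n ∨ l = m) :
    (G.cycleSubgraph v n m).IsSimpleCycle v l p :=
  ⟨hp.1, hp.2.1, hp.2.2.1, fun i => ⟨⟨l, p⟩, ⟨hp, hl⟩, i, rfl, rfl⟩, hp.2.2.2.2⟩

lemma transGen_of_lt {V : Type*} {H : DiGraph V} {l : ℕ} {p : Fin (l + 1) → V}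
    (hp : ∀ i : Fin l, H.Adj (p i.castSucc) (p i.succ)) {i j : ℕ} (hij : i < j) (hj : j < l + 1) :
    Relation.TransGen H.Adj (p ⟨i, by omega⟩) (p ⟨j, hj⟩) := by
  induction j, hij using Nat.le_induction with
  | base => exact Relation.TransGen.single (hp ⟨i, by omega⟩)
  | succ j hj' ih => exact (ih (by omega)).tail (hp ⟨j, by omega⟩)

lemma isConnected_cycleSubgraph {V : Type*} (G : DiGraph V) (v : V) (n m : ℕ) :
    (G.cycleSubgraph v n m).IsConnected := by
  have key : ∀ u ∈ (G.cycleSubgraph v n m).verts,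
      Relation.TransGen (G.cycleSubgraph v n m).Adj v u ∧
      Relation.TransGen (G.cycleSubgraph v n m).Adj u v := by
    rintro u ⟨⟨l, p⟩, ⟨hp, hl⟩, i, rfl⟩
    dsimp only at hp hl i
    have hH := isSimpleCycle_cycleSubgraph hp hl
    have hloop := transGen_of_lt hH.2.2.2.1 (i := 0) (j := l) hH.1 (by omega)
    have h0 : p ⟨0, by omega⟩ = v := hH.2.1
    have hL : p ⟨l, by omega⟩ = v := hH.2.2.1
    obtain ⟨i, hi⟩ := i
    dsimp only
    constructor
    · rcases Nat.eq_zero_or_pos i with rfl | hpos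
      · rw [h0]; rwa [h0, hL] at hloop
      · have := transGen_of_lt hH.2.2.2.1 hpos hi
        rwa [h0] at this
    · rcases eq_or_lt_of_le (Nat.lt_succ_iff.1 hi) with rfl | hlt
      · rw [hL]; rwa [h0, hL] at hloop
      · have := transGen_of_lt hH.2.2.2.1 hlt (by omega)
        rwa [hL] at this
  intro a ha b hb
  exact (key a ha).2.trans (key b hb).1

namespace IsLinear

lemma finite_cycleSubgraph (hG : IsLinear G) (n m : ℕ) :
    (G.cycleSubgraph 1 n m).verts.Finite := by
  obtain ⟨B, hBm, hB⟩ := hG.exists_reach_bound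
  refine (Set.finite_Iic (B (max n m))).subset ?_
  rintro u ⟨⟨l, p⟩, ⟨hp, hl⟩, i, rfl⟩
  refine (hB l p hp i).trans (hBm ?_)
  have := i.2
  dsimp only at *
  omega

lemma isExhaustive_cycleSubgraph (hG : IsLinear G) {n : ℕ → ℕ} (hn : StrictMono n) :
    G.IsExhaustive (fun k => G.cycleSubgraph 1 (n k) (n (k + 1))) := by
  have hk : ∀ k, k ≤ n k := hn.id_le
  -- The edge `(u, v)` lies on `1 → ⋯ → u → 1` or on `1 → ⋯ → u → v → 1`, where it starts at index
  -- `u - 1`. These cycles have length at most `u + 1`, and `k ≤ n k`.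
  have hadj : ∀ u v, G.Adj u v → ∃ k, (G.cycleSubgraph 1 (n k) (n (k + 1))).Adj u v := by
    intro u v huv
    have hu := hG.one_le huv
    by_cases hv : v = 1
    · subst hv
      refine ⟨u, ⟨u, _⟩, ⟨hG.isSimpleCycle_straight hu, Or.inl (hk u)⟩, ⟨u - 1, by
        dsimp only; omega⟩, ?_, ?_⟩
      · change (if u - 1 < u then u - 1 + 1 else 1) = u
        split_ifs <;> omega
      · change (if u - 1 + 1 < u then u - 1 + 1 + 1 else 1) = 1
        split_ifs <;> omega
    · refine ⟨u + 1, ⟨u + 1, _⟩, ⟨hG.isSimpleCycle_through hu huv hv, Or.inl (hk _)⟩,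
        ⟨u - 1, by dsimp only; omega⟩, ?_, ?_⟩
      · change (if u - 1 < u then u - 1 + 1 else if u - 1 = u then v else 1) = u
        split_ifs <;> omega
      · change (if u - 1 + 1 < u then u - 1 + 1 + 1 else if u - 1 + 1 = u then v else 1) = v
        split_ifs <;> omega
  refine ⟨fun k => ⟨?_, ?_⟩, ?_, fun u v => ⟨?_, hadj u v⟩⟩
  · rintro u ⟨γ, ⟨h1, h2⟩, h3⟩
    refine ⟨γ, ⟨h1, Or.inl ?_⟩, h3⟩
    have := hn.monotone (Nat.le_succ k)
    rcases h2 with h2 | h2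
    · exact h2.trans this
    · exact h2.le
  · rintro u v ⟨γ, ⟨h1, h2⟩, h3⟩
    refine ⟨γ, ⟨h1, Or.inl ?_⟩, h3⟩
    have := hn.monotone (Nat.le_succ k)
    rcases h2 with h2 | h2
    · exact h2.trans this
    · exact h2.le
  · apply Set.Subset.antisymm
    · refine Set.iUnion_subset fun k => ?_
      rintro u ⟨⟨l, p⟩, ⟨hp, -⟩, i, rfl⟩
      by_cases hi : i = Fin.last l
      · subst hi
        have := hp.2.2.1
        dsimp only at *
        rw [this, hG.verts_eq]
        exact le_refl 1
      · obtain ⟨i, rfl⟩ := Fin.exists_castSucc_eq.2 hi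
        exact G.fst_mem (hp.2.2.2.1 i)
    · intro u hu
      rw [hG.verts_eq] at hu
      obtain ⟨k, hk⟩ := hadj u 1 (hG.adj_one u hu)
      exact Set.mem_iUnion.2 ⟨k, DiGraph.fst_mem _ hk⟩
  · rintro ⟨k, h⟩
    exact adj_of_cycleSubgraph h

lemma cycleSum_cycleSubgraph_le (G : DiGraph ℕ) (W : ℕ → ℕ → ℝ) (n m l : ℕ) :
    (G.cycleSubgraph 1 n m).cycleSum W 1 l ≤ G.cycleSum W 1 l :=
  cycleSum_mono_of_imp fun _ hp => hp.mono fun _ _ h => adj_of_cycleSubgraph h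

lemma le_cycleSum_cycleSubgraph (G : DiGraph ℕ) (W : ℕ → ℕ → ℝ) {n m l : ℕ}
    (hl : l ≤ n ∨ l = m) : G.cycleSum W 1 l ≤ (G.cycleSubgraph 1 n m).cycleSum W 1 l :=
  cycleSum_mono_of_imp fun _ hp => isSimpleCycle_cycleSubgraph hp hl

/-- If `m` is large, then the simple `1`-cycles of `G_{n,m}` are either short, in terms of `n`, or
long. -/
lemma cycleSum_cycleSubgraph_eq_zero (hG : IsLinear G) {B : ℕ → ℕ} (hBm : Monotone B)
    (hB : ∀ (n : ℕ) (p : Fin (n + 1) → ℕ), G.IsSimpleCycle 1 n p → ∀ i : Fin (n + 1), p i ≤ B i)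
    {L l : ℕ} (hm : B L < m) (hl : B n < l) (hlL : l < L) :
    (G.cycleSubgraph 1 n m).cycleSum W 1 l = 0 := by
  refine cycleSum_eq_zero fun p hp => ?_
  have hpG := hp.mono fun _ _ h => adj_of_cycleSubgraph h
  have hl1 := hp.1
  have h1 := hG.index_lt hpG (l - 1) (by omega)
  have h2 := hB l p hpG ⟨l - 1, by omega⟩
  -- The closing edge of `p` belongs to a generating cycle `γ`, and as it ends in 1 it is the
  -- closing edge of `γ` too. So both cycles have the same last vertex before the return, which ties
  -- their lengths together.
  obtain ⟨⟨l', γ⟩, ⟨hγ, hl'⟩, i, hi1, hi2⟩ := hp.2.2.2.1 ⟨l - 1, by omega⟩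
  dsimp only at hγ hl' i hi1 hi2
  have hlast : (⟨l - 1, by omega⟩ : Fin l).succ = Fin.last l := by
    ext
    simp
    omega
  rw [hlast, hp.2.2.1] at hi2
  have hil : (i : ℕ) + 1 = l' := by
    by_contra hne
    exact hγ.2.2.2.2 i.succ (Fin.succ_ne_zero i) (fun h => hne (by simpa using congrArg Fin.val h))
      hi2
  have h3 := hG.index_lt hγ i i.2
  have h4 := hB l' γ hγ i.castSucc
  have e1 : γ ⟨i, by omega⟩ = γ i.castSucc := rfl
  rw [e1, hi1] at h3
  rw [hi1] at h4
  have e2 : (⟨l - 1, by omega⟩ : Fin l).castSucc = ⟨l - 1, by omega⟩ := rfl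
  rw [e2] at h3 h4
  simp only [Fin.val_castSucc] at h4
  -- If `γ` has length at most `n`, the common vertex is at most `B n`, whence `l ≤ B n`. If `γ` has
  -- length `m`, the vertex is at least `m`, but `p` reaches it in fewer than `L` steps, whence `m ≤
  -- B L`.
  rcases hl' with hl' | hl'
  · have := hBm (show (i : ℕ) ≤ n by omega)
    omega
  · have := hBm (show l - 1 ≤ L by omega)
    dsimp only at h2
    omega

/-- A simple 1-cycle is no longer than its largest vertex, so the generating function of a finite
`H` is a polynomial. It vanishes at zero and the loop at 1 makes it reach one. -/
lemma exists_genFun_eq_one (hG : IsLinear G) {H : DiGraph ℕ}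
    (hHG : ∀ u v, H.Adj u v → G.Adj u v) (hH : H.verts.Finite)
    (hq : ∀ l, H.cycleSum W 1 l ≠ ∞) (hq1 : H.cycleSum W 1 1 ≠ 0) :
    ∃ r : ℝ≥0, r ≠ 0 ∧ H.genFun W 1 r = 1 := by
  obtain ⟨N, hN⟩ := hH.bddAbove
  have hz : ∀ l, l ∉ Finset.range (N + 1) → H.cycleSum W 1 l = 0 := by
    intro l hl
    refine cycleSum_eq_zero fun p hp => ?_
    have hl1 := hp.1
    have h1 := hG.index_lt (hp.mono hHG) (l - 1) (by omega)
    have h2 : p ⟨l - 1, by omega⟩ ≤ N := hN (H.fst_mem (hp.2.2.2.1 ⟨l - 1, by omega⟩))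
    rw [Finset.mem_range] at hl
    omega
  set c : ℕ → ℝ≥0 := fun l => (H.cycleSum W 1 l).toNNReal with hc
  have hcc : ∀ l, (c l : ℝ≥0∞) = H.cycleSum W 1 l := fun l => ENNReal.coe_toNNReal (hq l)
  set f : ℝ≥0 → ℝ≥0 := fun z => ∑ l ∈ Finset.range (N + 1), c l * z ^ l with hf
  have hgf : ∀ z : ℝ≥0, H.genFun W 1 z = f z := by
    intro z
    rw [genFun, tsum_eq_sum (s := Finset.range (N + 1)) (fun l hl => by simp [hz l hl])]
    simp [hf, hcc]
  have hcont : Continuous f := by fun_prop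
  have hc1 : c 1 ≠ 0 := by
    intro h
    apply hq1
    rw [← hcc, h, ENNReal.coe_zero]
  have h0 : f 0 = 0 := by
    refine Finset.sum_eq_zero fun l _ => ?_
    rcases Nat.eq_zero_or_pos l with rfl | hl
    · simp [hc, cycleSum_zero]
    · simp [hl.ne']
  have hbig : 1 ≤ f (c 1)⁻¹ := by
    have h1N : 1 ∈ Finset.range (N + 1) := by
      by_contra h
      exact hq1 (hz 1 h)
    calc (1 : ℝ≥0) = c 1 * (c 1)⁻¹ ^ 1 := by rw [pow_one, mul_inv_cancel₀ hc1]
      _ ≤ _ := Finset.single_le_sum (f := fun l => c l * (c 1)⁻¹ ^ l) (fun _ _ => zero_le) h1N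
  obtain ⟨r, -, hr⟩ := intermediate_value_Icc (zero_le : (0 : ℝ≥0) ≤ (c 1)⁻¹) hcont.continuousOn
    (show (1 : ℝ≥0) ∈ Set.Icc (f 0) (f (c 1)⁻¹) from ⟨by simp [h0], hbig⟩)
  refine ⟨r, ?_, by rw [hgf, hr, ENNReal.coe_one]⟩
  rintro rfl
  simp [h0] at hr

/-- Otherwise the terms at `σ` are eventually dominated by the geometric series with ratio `σ / ρ <
1`. -/
lemma exists_large_term {q : ℕ → ℝ≥0∞} (hq : ∀ l, q l ≠ ∞) {σ ρ : ℝ≥0} (hσρ : σ < ρ)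
    (hdiv : ∑' l, q l * (σ : ℝ≥0∞) ^ l = ∞) (M : ℕ) :
    ∃ m, M ≤ m ∧ 1 ≤ q m * (ρ : ℝ≥0∞) ^ m := by
  by_contra! hcon
  have hρ : (ρ : ℝ≥0∞) ≠ 0 := by
    simpa using (lt_of_le_of_lt zero_le hσρ).ne'
  have hlt : (σ : ℝ≥0∞) / ρ < 1 := by
    rw [ENNReal.div_lt_iff (Or.inl hρ) (Or.inl (by simp)), one_mul]
    exact_mod_cast hσρ
  have h1 := ENNReal.summable.sum_add_tsum_nat_add' (f := fun l => q l * (σ : ℝ≥0∞) ^ l) (k := M)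
  rw [hdiv] at h1
  have h2 : ∑ l ∈ Finset.range M, q l * (σ : ℝ≥0∞) ^ l ≠ ∞ :=
    ENNReal.sum_ne_top.2 fun l _ => ENNReal.mul_ne_top (hq l) (by finiteness)
  have h3 : ∑' l, q (l + M) * (σ : ℝ≥0∞) ^ (l + M) ≠ ∞ := by
    have hle : ∑' l, q (l + M) * (σ : ℝ≥0∞) ^ (l + M) ≤ ∑' l, ((σ : ℝ≥0∞) / ρ) ^ l := by
      refine ENNReal.tsum_le_tsum fun l => ?_
      calc q (l + M) * (σ : ℝ≥0∞) ^ (l + M)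
          = q (l + M) * (ρ : ℝ≥0∞) ^ (l + M) * ((σ : ℝ≥0∞) / ρ) ^ (l + M) := by
            rw [mul_assoc, ← mul_pow, ENNReal.mul_div_cancel hρ (by simp)]
        _ ≤ 1 * ((σ : ℝ≥0∞) / ρ) ^ (l + M) := by
            gcongr
            exact (hcon (l + M) (by omega)).le
        _ ≤ ((σ : ℝ≥0∞) / ρ) ^ l := by
            rw [one_mul]
            exact pow_le_pow_right_of_le_one' hlt.le (by omega)
    refine ne_top_of_le_ne_top ?_ hle
    rw [ENNReal.tsum_geometric]
    exact ENNReal.inv_ne_top.2 (tsub_pos_of_lt hlt).ne'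
  exact ENNReal.add_ne_top.2 ⟨h2, h3⟩ h1

/-- For a suitable `m`, most of the length of the simple `1`-cycles of `G_{n,m}` is carried by
very long cycles. -/
lemma exists_long_cycles (hG : IsLinear G) (hW : ∀ i j, G.Adj i j → 0 < W i j)
    (hU : G.IsUnstablePositive W) (hn : 1 ≤ n) (K : ℝ≥0) :
    ∃ m > n, ∃ r : ℝ≥0, r ≠ 0 ∧ (G.cycleSubgraph 1 n m).genFun W 1 r = 1 ∧ ∃ L : ℕ,
      (K : ℝ≥0∞) ≤ L * ∑' l, (G.cycleSubgraph 1 n m).cycleSum W 1 (l + L) * (r : ℝ≥0∞) ^ (l + L) := by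
  obtain ⟨R, hR0, hR1, hdiv⟩ := hG.exists_critical_point hW hU
  obtain ⟨B, hBm, hB⟩ := hG.exists_reach_bound
  have hR0' : (R : ℝ≥0∞) ≠ 0 := by simpa using hR0
  set q : ℕ → ℝ≥0∞ := G.cycleSum W 1 with hq
  have hqtop : ∀ l, q l ≠ ∞ := by
    intro l
    have h1 : q l * (R : ℝ≥0∞) ^ l ≤ 1 := (ENNReal.le_tsum l).trans hR1
    exact ne_top_of_mul_le (pow_ne_zero l hR0') ENNReal.one_ne_top (by rwa [mul_comm])
  set A : ℝ≥0 → ℝ≥0∞ := fun z => ∑ l ∈ Finset.range (B n + 1), q l * (z : ℝ≥0∞) ^ l with hA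
  -- The cycles of length `B n + 1` have positive weight, so leaving them out of a sum that is at
  -- most one makes it strictly smaller.
  have hAR : A R < 1 := by
    have h1 : ∑ l ∈ Finset.range (B n + 1 + 1), q l * (R : ℝ≥0∞) ^ l ≤ 1 :=
      (ENNReal.sum_le_tsum _).trans hR1
    rw [Finset.sum_range_succ] at h1
    refine lt_of_lt_of_le (ENNReal.lt_add_right ?_ ?_) h1
    · exact ENNReal.sum_ne_top.2 fun l _ => ENNReal.mul_ne_top (hqtop l) (by finiteness)
    · exact mul_ne_zero (hG.cycleSum_ne_zero hW (by omega)) (pow_ne_zero _ hR0')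
  obtain ⟨a, haR, ha1⟩ := exists_between hAR
  have hAcont : Continuous A := by
    refine continuous_finsetSum _ fun l _ => ?_
    exact ENNReal.continuous_const_mul (hqtop l) |>.comp
      ((ENNReal.continuous_pow l).comp ENNReal.continuous_coe)
  obtain ⟨ρ, hρa, hρR⟩ : ∃ ρ, A ρ < a ∧ R < ρ := by
    have h1 : ∀ᶠ z in 𝓝[>] R, A z < a :=
      (hAcont.tendsto R).mono_left nhdsWithin_le_nhds |>.eventually_lt_const haR
    exact (h1.and self_mem_nhdsWithin).exists
  have hδ : 1 - a ≠ 0 := (tsub_pos_of_lt ha1).ne'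
  -- `L (1 - a) > K`, where `1 - a` will bound the mass of the long cycles from below.
  obtain ⟨L, hL⟩ := ENNReal.exists_nat_gt (ENNReal.div_ne_top (ENNReal.coe_ne_top (r := K)) hδ)
  obtain ⟨σ, hσ1, hσ2⟩ := exists_between hρR
  obtain ⟨m, hmM, hm⟩ := exists_large_term hqtop hσ2 (hdiv σ hσ1) (max (n + 1) (B L + 1))
  set H := G.cycleSubgraph 1 n m with hH
  have hHq : ∀ l, H.cycleSum W 1 l ≤ q l := cycleSum_cycleSubgraph_le G W n m
  obtain ⟨r, hr0, hr⟩ := hG.exists_genFun_eq_one (H := H) (W := W)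
    (fun _ _ h => adj_of_cycleSubgraph h) (hG.finite_cycleSubgraph n m)
    (fun l => ne_top_of_le_ne_top (hqtop l) (hHq l))
    (fun h => hG.cycleSum_ne_zero hW le_rfl
      (le_antisymm (h ▸ le_cycleSum_cycleSubgraph G W (Or.inl hn)) zero_le))
  refine ⟨m, by omega, r, hr0, hr, L, ?_⟩
  -- Beyond `ρ` the cycles of length `m` alone would have weight greater than one.
  have hrρ : r ≤ ρ := by
    by_contra! hlt
    have h1 : q m * (r : ℝ≥0∞) ^ m ≤ 1 := by
      rw [← hr]
      calc q m * (r : ℝ≥0∞) ^ m ≤ H.cycleSum W 1 m * (r : ℝ≥0∞) ^ m := by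
            gcongr
            exact le_cycleSum_cycleSubgraph G W (Or.inr rfl)
        _ ≤ _ := ENNReal.le_tsum m
    have h2 : q m * (ρ : ℝ≥0∞) ^ m < q m * (r : ℝ≥0∞) ^ m := by
      refine ENNReal.mul_lt_mul_right (hG.cycleSum_ne_zero hW (by omega)) (hqtop m) ?_
      exact ENNReal.pow_lt_pow_left (by omega) (by exact_mod_cast hlt)
    exact absurd (hm.trans_lt h2) (not_lt.2 h1)
  have hshort : ∑ l ∈ Finset.range L, H.cycleSum W 1 l * (r : ℝ≥0∞) ^ l ≤ a := by
    calc ∑ l ∈ Finset.range L, H.cycleSum W 1 l * (r : ℝ≥0∞) ^ l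
        ≤ ∑ l ∈ Finset.range (B n + 1), H.cycleSum W 1 l * (r : ℝ≥0∞) ^ l := by
          refine Finset.sum_le_sum_of_ne_zero fun l hl hne => ?_
          rw [Finset.mem_range] at hl ⊢
          by_contra hlt
          apply hne
          rw [hG.cycleSum_cycleSubgraph_eq_zero hBm hB (L := L) (by omega) (by omega) hl, zero_mul]
      _ ≤ A ρ := by
          refine Finset.sum_le_sum fun l _ => ?_
          exact mul_le_mul' (hHq l) (pow_le_pow_left' (by exact_mod_cast hrρ) l)
      _ ≤ a := hρa.le
  have hlong : 1 - a ≤ ∑' l, H.cycleSum W 1 (l + L) * (r : ℝ≥0∞) ^ (l + L) := by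
    have h1 := ENNReal.summable.sum_add_tsum_nat_add'
      (f := fun l => H.cycleSum W 1 l * (r : ℝ≥0∞) ^ l) (k := L)
    rw [genFun] at hr
    rw [hr] at h1
    rw [tsub_le_iff_left, ← h1]
    gcongr
  calc (K : ℝ≥0∞) = K / (1 - a) * (1 - a) := (ENNReal.div_mul_cancel hδ (by finiteness)).symm
    _ ≤ _ := by
      gcongr

end IsLinear

end Subgraph

/-! ### Gibbs' inequality with its equality case -/

section Gibbs

/-- This is `log t ≤ t - 1` for `t = b / a`. Because `Real.log 0 = 0`, the hypothesis `hab` must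
exclude `b = 0 < a`, where the divergence should be infinite. -/
lemma sub_le_mul_log_sub_log {a b : ℝ} (ha : 0 ≤ a) (hb : 0 ≤ b) (hab : b = 0 → a = 0) :
    a - b ≤ a * (Real.log a - Real.log b) := by
  rcases eq_or_lt_of_le ha with rfl | ha
  · simpa using hb
  · have hb' : 0 < b := lt_of_le_of_ne hb fun h => ha.ne' (hab h.symm)
    have h1 := Real.log_le_sub_one_of_pos (div_pos hb' ha)
    rw [Real.log_div hb'.ne' ha.ne'] at h1
    have h2 := mul_le_mul_of_nonneg_left h1 ha.le
    have h3 : a * (b / a - 1) = b - a := by field_simp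
    linarith

lemma eq_of_mul_log_sub_log_le {a b : ℝ} (ha : 0 ≤ a) (hb : 0 ≤ b) (hab : b = 0 → a = 0)
    (h : a * (Real.log a - Real.log b) ≤ a - b) : a = b := by
  rcases eq_or_lt_of_le ha with rfl | ha
  · simp only [zero_mul, zero_sub] at h
    linarith
  · have hb' : 0 < b := lt_of_le_of_ne hb fun h => ha.ne' (hab h.symm)
    by_contra hne
    have h1 := Real.log_lt_sub_one_of_pos (div_pos hb' ha)
      (fun h => hne ((div_eq_one_iff_eq ha.ne').1 h).symm)
    rw [Real.log_div hb'.ne' ha.ne'] at h1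
    have h2 := mul_lt_mul_of_pos_left h1 ha
    have h3 : a * (b / a - 1) = b - a := by field_simp
    linarith

variable {ι : Type*} [Fintype ι] {a b : ι → ℝ}

lemma gibbs_inequality (ha : ∀ i, 0 ≤ a i) (hb : ∀ i, 0 ≤ b i) (hab : ∀ i, b i = 0 → a i = 0)
    (hsum : ∑ i, b i ≤ ∑ i, a i) : 0 ≤ ∑ i, a i * (Real.log (a i) - Real.log (b i)) := by
  calc (0 : ℝ) ≤ ∑ i, (a i - b i) := by rw [Finset.sum_sub_distrib]; linarith
    _ ≤ _ := Finset.sum_le_sum fun i _ => sub_le_mul_log_sub_log (ha i) (hb i) (hab i)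

lemma eq_of_gibbs_le (ha : ∀ i, 0 ≤ a i) (hb : ∀ i, 0 ≤ b i) (hab : ∀ i, b i = 0 → a i = 0)
    (hsum : ∑ i, b i ≤ ∑ i, a i) (h : ∑ i, a i * (Real.log (a i) - Real.log (b i)) ≤ 0) (i : ι) :
    a i = b i := by
  have h1 : ∑ i, (a i * (Real.log (a i) - Real.log (b i)) - (a i - b i)) ≤ 0 := by
    rw [Finset.sum_sub_distrib, Finset.sum_sub_distrib]
    linarith
  have h2 : ∀ i ∈ Finset.univ, 0 ≤ a i * (Real.log (a i) - Real.log (b i)) - (a i - b i) :=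
    fun i _ => sub_nonneg.2 (sub_le_mul_log_sub_log (ha i) (hb i) (hab i))
  have h3 := (Finset.sum_eq_zero_iff_of_nonneg h2).1 (le_antisymm h1 (Finset.sum_nonneg h2)) i
    (Finset.mem_univ i)
  exact eq_of_mul_log_sub_log_le (ha i) (hb i) (hab i) (by linarith)

end Gibbs

/-! ### Entropy of stationary laws on a finite alphabet -/

section BlockLaw

variable {α : Type*} [Fintype α]

lemma sum_fin_snoc {n : ℕ} (f : (Fin (n + 1) → α) → ℝ) :
    ∑ w, f w = ∑ w : Fin n → α, ∑ a, f (Fin.snoc w a : Fin (n + 1) → α) := by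
  rw [← Fintype.sum_prod_type_right', ← (Fin.snocEquiv fun _ : Fin (n + 1) => α).sum_comp]
  rfl

lemma sum_fin_cons {n : ℕ} (f : (Fin (n + 1) → α) → ℝ) :
    ∑ w, f w = ∑ w : Fin n → α, ∑ a, f (Fin.cons a w : Fin (n + 1) → α) := by
  rw [← Fintype.sum_prod_type_right', ← (Fin.consEquiv fun _ : Fin (n + 1) => α).sum_comp]
  rfl

/-- The finite-dimensional distributions of a stationary process with values in `α`. -/
structure IsBlockLaw (p : ∀ n : ℕ, (Fin n → α) → ℝ) : Prop where
  nonneg : ∀ n w, 0 ≤ p n w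
  zero : ∀ w, p 0 w = 1
  sum_snoc : ∀ n (w : Fin n → α), ∑ a, p (n + 1) (Fin.snoc w a : Fin (n + 1) → α) = p n w
  sum_cons : ∀ n (w : Fin n → α), ∑ a, p (n + 1) (Fin.cons a w : Fin (n + 1) → α) = p n w

/-- The entropy of the blocks of length `n`. -/
noncomputable def lawEntropy (p : ∀ n : ℕ, (Fin n → α) → ℝ) (n : ℕ) : ℝ :=
  ∑ w, Real.negMulLog (p n w)

/-- The mean logarithm of the transition probabilities `P` of successive letters. -/
noncomputable def meanLog (p : ∀ n : ℕ, (Fin n → α) → ℝ) (P : α → α → ℝ) : ℝ :=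
  ∑ w : Fin 2 → α, p 2 w * Real.log (P (w 0) (w 1))

namespace IsBlockLaw

variable {p : ∀ n : ℕ, (Fin n → α) → ℝ}

lemma le_init (hp : IsBlockLaw p) {n : ℕ} (w : Fin (n + 1) → α) : p (n + 1) w ≤ p n (Fin.init w) := by
  rw [← hp.sum_snoc n]
  conv_lhs => rw [← Fin.snoc_init_self w]
  exact Finset.single_le_sum (f := fun a => p (n + 1) (Fin.snoc (Fin.init w) a : Fin (n + 1) → α))
    (fun a _ => hp.nonneg _ _) (Finset.mem_univ _)

lemma le_tail (hp : IsBlockLaw p) {n : ℕ} (w : Fin (n + 1) → α) : p (n + 1) w ≤ p n (Fin.tail w) := by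
  rw [← hp.sum_cons n]
  conv_lhs => rw [← Fin.cons_self_tail w]
  exact Finset.single_le_sum (f := fun a => p (n + 1) (Fin.cons a (Fin.tail w) : Fin (n + 1) → α))
    (fun a _ => hp.nonneg _ _) (Finset.mem_univ _)

lemma le_one (hp : IsBlockLaw p) {n : ℕ} (w : Fin n → α) : p n w ≤ 1 := by
  induction n with
  | zero => exact (hp.zero w).le
  | succ n ih => exact (hp.le_init w).trans (ih _)

lemma sum_mul_init (hp : IsBlockLaw p) {n : ℕ} (F : (Fin n → α) → ℝ) :
    ∑ w : Fin (n + 1) → α, p (n + 1) w * F (Fin.init w) = ∑ w, p n w * F w := by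
  rw [sum_fin_snoc]
  refine Finset.sum_congr rfl fun w _ => ?_
  simp only [Fin.init_snoc]
  rw [← Finset.sum_mul, hp.sum_snoc]

lemma sum_mul_tail (hp : IsBlockLaw p) {n : ℕ} (F : (Fin n → α) → ℝ) :
    ∑ w : Fin (n + 1) → α, p (n + 1) w * F (Fin.tail w) = ∑ w, p n w * F w := by
  rw [sum_fin_cons]
  refine Finset.sum_congr rfl fun w _ => ?_
  simp only [Fin.tail_cons]
  rw [← Finset.sum_mul, hp.sum_cons]

lemma sum_eq_one (hp : IsBlockLaw p) (n : ℕ) : ∑ w, p n w = 1 := by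
  induction n with
  | zero => simp [hp.zero]
  | succ n ih => simpa using (hp.sum_mul_init (n := n) fun _ => 1).trans (by simpa using ih)

lemma lawEntropy_eq (n : ℕ) : lawEntropy p n = -∑ w, p n w * Real.log (p n w) := by
  simp [lawEntropy, Real.negMulLog, Finset.sum_neg_distrib]

lemma lawEntropy_nonneg (hp : IsBlockLaw p) (n : ℕ) : 0 ≤ lawEntropy p n :=
  Finset.sum_nonneg fun w _ => Real.negMulLog_nonneg (hp.nonneg n w) (hp.le_one w)

/-- The entropy of the blocks is a concave function of their length. -/
lemma lawEntropy_concave (hp : IsBlockLaw p) (n : ℕ) :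
    lawEntropy p (n + 2) - lawEntropy p (n + 1) ≤ lawEntropy p (n + 1) - lawEntropy p n := by
  -- The law that makes the two end letters conditionally independent given the middle block. Gibbs'
  -- inequality against it is strong subadditivity.
  set b : (Fin (n + 2) → α) → ℝ := fun w =>
    p (n + 1) (Fin.init w) * (p (n + 1) (Fin.tail w) / p n (Fin.tail (Fin.init w))) with hb
  have hmid : ∀ w : Fin (n + 2) → α, p (n + 2) w ≠ 0 → p (n + 1) (Fin.init w) ≠ 0 ∧
      p (n + 1) (Fin.tail w) ≠ 0 ∧ p n (Fin.tail (Fin.init w)) ≠ 0 := by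
    intro w hw
    have h0 := lt_of_le_of_ne (hp.nonneg _ w) hw.symm
    have h1 := h0.trans_le (hp.le_init w)
    exact ⟨h1.ne', (h0.trans_le (hp.le_tail w)).ne', (h1.trans_le (hp.le_tail _)).ne'⟩
  have hgibbs := gibbs_inequality (a := p (n + 2)) (b := b) (hp.nonneg _)
    (fun w => mul_nonneg (hp.nonneg _ _) (div_nonneg (hp.nonneg _ _) (hp.nonneg _ _)))
    (fun w hw => by
      by_contra hne
      obtain ⟨h1, h2, h3⟩ := hmid w hne
      exact (mul_ne_zero h1 (div_ne_zero h2 h3)) hw)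
    (by
      rw [hp.sum_eq_one, sum_fin_snoc, ← hp.sum_eq_one (n + 1)]
      refine Finset.sum_le_sum fun w _ => ?_
      have htail : ∀ a : α, Fin.tail (Fin.snoc w a : Fin (n + 2) → α) =
          (Fin.snoc (Fin.tail w) a : Fin (n + 1) → α) := by
        intro a
        conv_lhs => rw [← Fin.cons_self_tail w, ← Fin.cons_snoc_eq_snoc_cons]
        exact Fin.tail_cons _ _
      simp only [hb, Fin.init_snoc, htail]
      rw [← Finset.mul_sum, ← Finset.sum_div, hp.sum_snoc]
      -- Only an inequality: the quotient is `0 / 0 = 0` when the middle block has probability zero.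
      exact mul_le_of_le_one_right (hp.nonneg _ _) (div_self_le_one _))
  have hlog : ∀ w : Fin (n + 2) → α, p (n + 2) w * (Real.log (p (n + 2) w) - Real.log (b w)) =
      p (n + 2) w * Real.log (p (n + 2) w) - p (n + 2) w * Real.log (p (n + 1) (Fin.init w))
        - p (n + 2) w * Real.log (p (n + 1) (Fin.tail w))
        + p (n + 2) w * Real.log (p n (Fin.tail (Fin.init w))) := by
    intro w
    by_cases hw : p (n + 2) w = 0
    · simp [hw]
    · obtain ⟨h1, h2, h3⟩ := hmid w hw
      rw [hb, Real.log_mul h1 (div_ne_zero h2 h3), Real.log_div h2 h3]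
      ring
  simp only [hlog, Finset.sum_add_distrib, Finset.sum_sub_distrib] at hgibbs
  rw [hp.sum_mul_init (fun w => Real.log (p (n + 1) w)),
    hp.sum_mul_tail (fun w => Real.log (p (n + 1) w)),
    hp.sum_mul_init (fun w => Real.log (p n (Fin.tail w))),
    hp.sum_mul_tail (fun w => Real.log (p n w))] at hgibbs
  simp only [lawEntropy_eq]
  linarith

lemma lawEntropy_add_le (hp : IsBlockLaw p) (m n : ℕ) :
    lawEntropy p (m + n) ≤ lawEntropy p m + n * (lawEntropy p (m + 1) - lawEntropy p m) := by
  have hanti : Antitone fun n => lawEntropy p (n + 1) - lawEntropy p n :=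
    antitone_nat_of_succ_le fun n => hp.lawEntropy_concave n
  induction n with
  | zero => simp
  | succ n ih =>
    have := hanti (Nat.le_add_right m n)
    dsimp only at this
    push_cast
    rw [← add_assoc]
    linarith

/-- By concavity the block entropy grows beyond `m` at most linearly, with slope the increment at
`m`. -/
lemma limsup_lawEntropy_le (hp : IsBlockLaw p) (m : ℕ) :
    limsup (fun n : ℕ => lawEntropy p n / n) atTop ≤ lawEntropy p (m + 1) - lawEntropy p m := by
  set c := lawEntropy p (m + 1) - lawEntropy p m with hc
  have hlim : Tendsto (fun n : ℕ => (lawEntropy p m - m * c) / (n : ℝ) + c) atTop (𝓝 c) := by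
    simpa using (tendsto_const_div_atTop_nhds_zero_nat (lawEntropy p m - m * c)).add_const c
  rw [← hlim.limsup_eq]
  refine limsup_le_limsup ?_ ?_ hlim.isBoundedUnder_le
  · filter_upwards [eventually_ge_atTop (m + 1)] with n hn
    obtain ⟨l, rfl⟩ := Nat.exists_eq_add_of_le (show m ≤ n by omega)
    have hpos : (0 : ℝ) < ((m + l : ℕ) : ℝ) := by
      have : 0 < m + l := by omega
      exact_mod_cast this
    rw [div_add' _ _ _ hpos.ne', div_le_div_iff_of_pos_right hpos]
    have := hp.lawEntropy_add_le m l
    push_cast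
    linarith
  · refine IsBoundedUnder.isCoboundedUnder_le ⟨0, ?_⟩
    rw [eventually_map]
    exact Eventually.of_forall fun n => div_nonneg (hp.lawEntropy_nonneg n) (Nat.cast_nonneg n)

variable {P : α → α → ℝ}

lemma sum_mul_last (hp : IsBlockLaw p) (F : α → α → ℝ) (n : ℕ) :
    ∑ w : Fin (n + 2) → α, p (n + 2) w * F (w (Fin.last n).castSucc) (w (Fin.last (n + 1))) =
      ∑ w : Fin 2 → α, p 2 w * F (w 0) (w 1) := by
  induction n with
  | zero => rfl
  | succ n ih =>
    rw [← ih, ← hp.sum_mul_tail (n := n + 2)]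
    rfl

/-- The entropy increments are bounded by the mean logarithm of any transition matrix `P`, with
equality only if `P` gives the transition probabilities. -/
lemma lawEntropy_succ_sub_le (hp : IsBlockLaw p) (hP0 : ∀ i j, 0 ≤ P i j)
    (hP1 : ∀ i, ∑ j, P i j = 1) (hPp : ∀ w : Fin 2 → α, p 2 w ≠ 0 → P (w 0) (w 1) ≠ 0) (n : ℕ) :
    lawEntropy p (n + 2) - lawEntropy p (n + 1) ≤ -meanLog p P ∧
    (-meanLog p P ≤ lawEntropy p (n + 2) - lawEntropy p (n + 1) → ∀ w : Fin (n + 2) → α,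
      p (n + 2) w =
        p (n + 1) (Fin.init w) * P (w (Fin.last n).castSucc) (w (Fin.last (n + 1)))) := by
  set b : (Fin (n + 2) → α) → ℝ := fun w =>
    p (n + 1) (Fin.init w) * P (w (Fin.last n).castSucc) (w (Fin.last (n + 1))) with hb
  have hne : ∀ w : Fin (n + 2) → α, p (n + 2) w ≠ 0 → p (n + 1) (Fin.init w) ≠ 0 ∧
      P (w (Fin.last n).castSucc) (w (Fin.last (n + 1))) ≠ 0 := by
    intro w hw
    have h0 := lt_of_le_of_ne (hp.nonneg _ w) hw.symm
    refine ⟨(h0.trans_le (hp.le_init w)).ne', ?_⟩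
    clear_value b
    clear hb b
    -- A block of positive probability has a tail of positive probability, so the claim reduces to
    -- the last two letters.
    induction n with
    | zero => exact hPp w hw
    | succ n ih =>
      have h1 := h0.trans_le (hp.le_tail w)
      exact ih (Fin.tail w) h1.ne' h1
  have hb0 : ∀ w, 0 ≤ b w := fun w => mul_nonneg (hp.nonneg _ _) (hP0 _ _)
  have hab : ∀ w, b w = 0 → p (n + 2) w = 0 := by
    intro w hw
    by_contra h
    obtain ⟨h1, h2⟩ := hne w h
    exact mul_ne_zero h1 h2 hw
  have hsum : ∑ w, b w ≤ ∑ w, p (n + 2) w := by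
    rw [hp.sum_eq_one, sum_fin_snoc, ← hp.sum_eq_one (n + 1)]
    refine Finset.sum_le_sum fun w _ => ?_
    simp only [hb, Fin.init_snoc, Fin.snoc_last, Fin.snoc_castSucc]
    rw [← Finset.mul_sum, hP1, mul_one]
  have hlog : ∀ w : Fin (n + 2) → α, p (n + 2) w * (Real.log (p (n + 2) w) - Real.log (b w)) =
      p (n + 2) w * Real.log (p (n + 2) w) - p (n + 2) w * Real.log (p (n + 1) (Fin.init w))
        - p (n + 2) w * Real.log (P (w (Fin.last n).castSucc) (w (Fin.last (n + 1)))) := by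
    intro w
    by_cases hw : p (n + 2) w = 0
    · simp [hw]
    · obtain ⟨h1, h2⟩ := hne w hw
      rw [hb, Real.log_mul h1 h2]
      ring
  have heq : ∑ w, p (n + 2) w * (Real.log (p (n + 2) w) - Real.log (b w)) =
      lawEntropy p (n + 1) - lawEntropy p (n + 2) - meanLog p P := by
    simp only [hlog, Finset.sum_sub_distrib]
    rw [hp.sum_mul_init (fun w => Real.log (p (n + 1) w)),
      hp.sum_mul_last (fun i j => Real.log (P i j))]
    simp only [lawEntropy_eq, meanLog]
    ring
  constructor
  · have := gibbs_inequality (hp.nonneg (n + 2)) hb0 hab hsum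
    linarith
  · intro h w
    exact eq_of_gibbs_le (hp.nonneg (n + 2)) hb0 hab hsum (by linarith) w

lemma limsup_lawEntropy_le_neg_meanLog (hp : IsBlockLaw p) (hP0 : ∀ i j, 0 ≤ P i j)
    (hP1 : ∀ i, ∑ j, P i j = 1) (hPp : ∀ w : Fin 2 → α, p 2 w ≠ 0 → P (w 0) (w 1) ≠ 0) :
    limsup (fun n : ℕ => lawEntropy p n / n) atTop ≤ -meanLog p P :=
  (hp.limsup_lawEntropy_le 1).trans (hp.lawEntropy_succ_sub_le hP0 hP1 hPp 0).1

/-- A stationary law for which the entropy bound is attained is the law of a Markov chain. -/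
lemma eq_mul_of_le_limsup (hp : IsBlockLaw p) (hP0 : ∀ i j, 0 ≤ P i j)
    (hP1 : ∀ i, ∑ j, P i j = 1) (hPp : ∀ w : Fin 2 → α, p 2 w ≠ 0 → P (w 0) (w 1) ≠ 0)
    (h : -meanLog p P ≤ limsup (fun n : ℕ => lawEntropy p n / n) atTop) (n : ℕ)
    (w : Fin (n + 2) → α) :
    p (n + 2) w = p (n + 1) (Fin.init w) * P (w (Fin.last n).castSucc) (w (Fin.last (n + 1))) :=
  (hp.lawEntropy_succ_sub_le hP0 hP1 hPp n).2 (h.trans (hp.limsup_lawEntropy_le (n + 1))) w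

/-- For a Markov law the chain rule makes every entropy increment from length one on equal to
`-meanLog p P`. -/
lemma limsup_lawEntropy_of_markov (hp : IsBlockLaw p)
    (hM : ∀ n (w : Fin (n + 2) → α),
      p (n + 2) w = p (n + 1) (Fin.init w) * P (w (Fin.last n).castSucc) (w (Fin.last (n + 1)))) :
    limsup (fun n : ℕ => lawEntropy p n / n) atTop = -meanLog p P := by
  have hstep : ∀ n, lawEntropy p (n + 2) = lawEntropy p (n + 1) - meanLog p P := by
    intro n
    have hlog : ∀ w : Fin (n + 2) → α, p (n + 2) w * Real.log (p (n + 2) w) =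
        p (n + 2) w * Real.log (p (n + 1) (Fin.init w))
        + p (n + 2) w * Real.log (P (w (Fin.last n).castSucc) (w (Fin.last (n + 1)))) := by
      intro w
      by_cases hw : p (n + 2) w = 0
      · simp [hw]
      · have h1 := hM n w
        have h2 := hw
        rw [h1] at h2
        rw [← mul_add, ← Real.log_mul (left_ne_zero_of_mul h2) (right_ne_zero_of_mul h2), ← h1]
    simp only [lawEntropy_eq, hlog, Finset.sum_add_distrib]
    rw [hp.sum_mul_init (fun w => Real.log (p (n + 1) w)),
      hp.sum_mul_last (fun i j => Real.log (P i j)), meanLog]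
    ring
  have hall : ∀ n : ℕ, lawEntropy p (n + 1) = lawEntropy p 1 - n * meanLog p P := by
    intro n
    induction n with
    | zero => simp
    | succ n ih =>
      rw [hstep, ih]
      push_cast
      ring
  refine Tendsto.limsup_eq ?_
  have hlim : Tendsto (fun n : ℕ => (lawEntropy p 1 + meanLog p P) / (n : ℝ) - meanLog p P) atTop
      (𝓝 (-meanLog p P)) := by
    simpa using (tendsto_const_div_atTop_nhds_zero_nat
      (lawEntropy p 1 + meanLog p P)).sub_const (meanLog p P)
  refine hlim.congr' ?_
  filter_upwards [eventually_ge_atTop 1] with n hn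
  obtain ⟨l, rfl⟩ := Nat.exists_eq_add_of_le' hn
  have hpos : ((l + 1 : ℕ) : ℝ) ≠ 0 := by positivity
  rw [hall l, div_sub' hpos]
  congr 1
  push_cast
  ring

end IsBlockLaw

end BlockLaw

open ProbabilityTheory

/-! ### Construction of the two-sided stationary Markov measure -/

section MarkovMeasure

lemma measure_eq_sum_fiber {Ω β : Type*} [MeasurableSpace Ω] [MeasurableSpace β]
    [MeasurableSingletonClass β] (μ : Measure Ω) {f : Ω → β} (hf : Measurable f) (s : Finset β)
    {A : Set Ω} (hs : ∀ᵐ ω ∂μ, f ω ∈ s) : μ A = ∑ b ∈ s, μ (f ⁻¹' {b} ∩ A) := by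
  have h1 := sum_measure_preimage_singleton (μ := μ.restrict A) s (f := f)
    fun y _ => hf (measurableSet_singleton y)
  simp only [Measure.restrict_apply (hf (measurableSet_singleton _))] at h1
  rw [h1, Measure.restrict_apply (hf s.measurableSet)]
  refine measure_congr ?_
  filter_upwards [hs] with ω hω
  refine propext ⟨fun h => ⟨hω, h⟩, fun h => h.2⟩

/-- The law of a Markov chain with discrete state space. -/
lemma exists_chain {β : Type*} [MeasurableSpace β] [Countable β] [MeasurableSingletonClass β]
    (μ₀ : Measure β) [IsProbabilityMeasure μ₀] (κ : Kernel β β) [IsMarkovKernel κ] :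
    ∃ T : Measure (ℕ → β), IsProbabilityMeasure T ∧ ∀ (n : ℕ) (e : ℕ → β),
      T {η | ∀ i ≤ n, η i = e i} = μ₀ {e 0} * ∏ i ∈ Finset.range n, κ (e i) {e (i + 1)} := by
  -- The transition depends on the history only through its last coordinate.
  set κ' : (n : ℕ) → Kernel (Π _ : Finset.Iic n, β) β := fun n =>
    κ.comap (fun x => x ⟨n, Finset.mem_Iic.2 le_rfl⟩) (by fun_prop) with hκ'
  have hMk : ∀ n, IsMarkovKernel (κ' n) := fun n => by rw [hκ']; infer_instance
  set T := Kernel.trajMeasure (X := fun _ => β) μ₀ κ' with hT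
  have hfr : ∀ n (e : ℕ → β), Preorder.frestrictLe (π := fun _ => β) n ⁻¹' {Preorder.frestrictLe n e}
      = {η | ∀ i ≤ n, η i = e i} := by
    intro n e
    ext η
    simp only [Set.mem_preimage, Set.mem_singleton_iff, Set.mem_ofPred_eq]
    constructor
    · intro h i hi
      exact congrFun h ⟨i, Finset.mem_Iic.2 hi⟩
    · intro h
      funext i
      exact h i (Finset.mem_Iic.1 i.2)
  refine ⟨T, by rw [hT]; infer_instance, fun n e => ?_⟩
  induction n with
  | zero =>
    rw [← hfr, ← Measure.map_apply (by fun_prop) (measurableSet_singleton _), hT,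
      Kernel.trajMeasure, Measure.map_comp _ _ (by fun_prop), Kernel.traj_map_frestrictLe,
      Kernel.partialTraj_self, Measure.id_comp,
      Measure.map_apply (by fun_prop) (measurableSet_singleton _)]
    simp only [Finset.range_zero, Finset.prod_empty, mul_one]
    congr 1
    ext b
    simp only [Set.mem_preimage, Set.mem_singleton_iff]
    constructor
    · intro h
      exact congrFun h ⟨0, by simp⟩
    · rintro rfl
      funext ⟨i, hi⟩
      obtain rfl : i = 0 := by simpa using hi
      rfl
  | succ n ih =>
    have h1 := Kernel.map_frestrictLe_trajMeasure_compProd_eq_map_trajMeasure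
      (X := fun _ => β) (μ₀ := μ₀) (κ := κ') (a := n)
    have h2 := congrArg (fun m => m ({Preorder.frestrictLe n e} ×ˢ {e (n + 1)})) h1
    rw [Measure.compProd_apply_prod (measurableSet_singleton _) (measurableSet_singleton _),
      lintegral_singleton, Measure.map_apply (by fun_prop) (measurableSet_singleton _), hfr,
      Measure.map_apply (by fun_prop)
        ((measurableSet_singleton _).prod (measurableSet_singleton _)), ← hT, ih] at h2
    rw [Finset.prod_range_succ, ← mul_assoc, mul_comm]
    have h3 : κ' n (Preorder.frestrictLe n e) {e (n + 1)} = κ (e n) {e (n + 1)} := by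
      rw [hκ', Kernel.comap_apply]
      rfl
    rw [← h3, h2]
    congr 1
    ext η
    have := congrArg (η ∈ ·) (hfr n e)
    simp only [Set.mem_preimage, Set.mem_singleton_iff, Set.mem_ofPred_eq, eq_iff_iff] at this
    simp only [Set.mem_preimage, Set.mem_prod, Set.mem_singleton_iff, Set.mem_ofPred_eq, this]
    constructor
    · intro h
      exact ⟨fun i hi => h i (by omega), h _ le_rfl⟩
    · rintro ⟨h, h'⟩ i hi
      rcases Nat.le_succ_iff.1 hi with hi | rfl
      · exact h i hi
      · exact h'

variable {α : Type*} [Fintype α]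

lemma exists_kernel_of_stochastic [MeasurableSpace α] [MeasurableSingletonClass α] (P : α → α → ℝ) (hP0 : ∀ i j, 0 ≤ P i j)
    (hP1 : ∀ i, ∑ j, P i j = 1) :
    ∃ κ : Kernel α α, IsMarkovKernel κ ∧ ∀ i j, κ i {j} = ENNReal.ofReal (P i j) := by
  have hsum : ∀ i, ∑ j, ENNReal.ofReal (P i j) = 1 := fun i => by
    rw [← ENNReal.ofReal_sum_of_nonneg fun j _ => hP0 i j, hP1, ENNReal.ofReal_one]
  refine ⟨Kernel.ofFunOfCountable fun i => (PMF.ofFintype _ (hsum i)).toMeasure,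
    ⟨fun i => ?_⟩, fun i j => ?_⟩
  · change IsProbabilityMeasure (PMF.ofFintype _ (hsum i)).toMeasure
    infer_instance
  · change (PMF.ofFintype _ (hsum i)).toMeasure {j} = _
    rw [PMF.toMeasure_apply_singleton _ _ (measurableSet_singleton j)]
    rfl

/-- The weight of a path under a Markov chain started in the distribution `π`. -/
noncomputable def chainWeight (π : α → ℝ) (P : α → α → ℝ) (a : ℤ) (n : ℕ) (s : ℤ → α) : ℝ :=
  π (s a) * ∏ i ∈ Finset.range n, P (s (a + i)) (s (a + i + 1))

/-- The sequences that agree with `s` on `{a, …, a + n}`. -/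
def agreeSet {α : Type*} (a : ℤ) (n : ℕ) (s : ℤ → α) : Set (ℤ → α) :=
  {ω | ∀ i : ℕ, i ≤ n → ω (a + i) = s (a + i)}

lemma agreeSet_update_right {α : Type*} (a : ℤ) (n : ℕ) (s : ℤ → α) (x : α) :
    agreeSet a (n + 1) (Function.update s (a + n + 1) x) =
      (fun ω : ℤ → α => ω (a + n + 1)) ⁻¹' {x} ∩ agreeSet a n s := by
  ext ω
  simp only [agreeSet, Set.mem_ofPred_eq, Set.mem_inter_iff, Set.mem_preimage,
    Set.mem_singleton_iff]
  constructor
  · intro h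
    refine ⟨by simpa [add_assoc] using h (n + 1) le_rfl, fun i hi => ?_⟩
    rw [h i (by omega), Function.update_of_ne (by omega)]
  · rintro ⟨h1, h2⟩ i hi
    rcases Nat.le_succ_iff.1 hi with hi | rfl
    · rw [h2 i hi, Function.update_of_ne (by omega)]
    · simpa [add_assoc] using h1

lemma agreeSet_update_left {α : Type*} (a : ℤ) (n : ℕ) (s : ℤ → α) (x : α) :
    agreeSet a (n + 1) (Function.update s a x) =
      (fun ω : ℤ → α => ω a) ⁻¹' {x} ∩ agreeSet (a + 1) n s := by
  ext ω
  simp only [agreeSet, Set.mem_ofPred_eq, Set.mem_inter_iff, Set.mem_preimage,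
    Set.mem_singleton_iff]
  constructor
  · intro h
    refine ⟨by simpa using h 0 (by omega), fun i hi => ?_⟩
    have := h (i + 1) (by omega)
    rw [Function.update_of_ne (by omega)] at this
    have e : a + ((i + 1 : ℕ) : ℤ) = a + 1 + i := by push_cast; ring
    rwa [e] at this
  · rintro ⟨h1, h2⟩ i hi
    rcases i with _ | i
    · simpa using h1
    · rw [Function.update_of_ne (by omega)]
      have := h2 i (by omega)
      have e : a + ((i + 1 : ℕ) : ℤ) = a + 1 + i := by push_cast; ring
      rwa [e]

lemma sum_chainWeight_update_right {π : α → ℝ} {P : α → α → ℝ} (hP1 : ∀ i, ∑ j, P i j = 1)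
    (a : ℤ) (n : ℕ) (s : ℤ → α) :
    ∑ x, chainWeight π P a (n + 1) (Function.update s (a + n + 1) x) = chainWeight π P a n s := by
  have : ∀ x, chainWeight π P a (n + 1) (Function.update s (a + n + 1) x) =
      chainWeight π P a n s * P (s (a + n)) x := by
    intro x
    simp only [chainWeight]
    rw [Finset.prod_range_succ, ← mul_assoc]
    congr 1
    · rw [Function.update_of_ne (by omega)]
      congr 1
      refine Finset.prod_congr rfl fun i hi => ?_
      rw [Finset.mem_range] at hi
      rw [Function.update_of_ne (by omega), Function.update_of_ne (by omega)]
    · rw [Function.update_of_ne (by omega), Function.update_self]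
  simp only [this]
  rw [← Finset.mul_sum, hP1, mul_one]

/-- Summing out the first letter uses stationarity of `π`, whereas summing out the last one only
uses that the rows of `P` sum to one. -/
lemma sum_chainWeight_update_left {π : α → ℝ} {P : α → α → ℝ}
    (hstat : ∀ j, ∑ i, π i * P i j = π j) (a : ℤ) (n : ℕ) (s : ℤ → α) :
    ∑ x, chainWeight π P a (n + 1) (Function.update s a x) = chainWeight π P (a + 1) n s := by
  have : ∀ x, chainWeight π P a (n + 1) (Function.update s a x) =
      π x * P x (s (a + 1)) * ∏ i ∈ Finset.range n, P (s (a + 1 + i)) (s (a + 1 + i + 1)) := by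
    intro x
    simp only [chainWeight]
    rw [Finset.prod_range_succ', mul_comm (∏ i ∈ _, _), ← mul_assoc]
    congr 1
    · simp
    · refine Finset.prod_congr rfl fun i hi => ?_
      rw [Function.update_of_ne (by omega), Function.update_of_ne (by omega)]
      push_cast
      congr 2 <;> ring_nf
  simp only [this]
  rw [← Finset.sum_mul, hstat, chainWeight]

lemma measurableSet_agreeSet {α : Type*} [MeasurableSpace α] [MeasurableSingletonClass α]
    (a : ℤ) (n : ℕ) (s : ℤ → α) : MeasurableSet (agreeSet a n s) := by
  have : agreeSet a n s = ⋂ i : ℕ, ⋂ _ : i ≤ n, (fun ω : ℤ → α => ω (a + i)) ⁻¹' {s (a + i)} := by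
    ext ω
    simp [agreeSet]
  rw [this]
  exact MeasurableSet.iInter fun i => MeasurableSet.iInter fun _ =>
    (measurable_pi_apply _) (measurableSet_singleton _)

lemma chainWeight_nonneg {α : Type*} {π : α → ℝ} {P : α → α → ℝ} (hπ : ∀ i, 0 ≤ π i) (hP0 : ∀ i j, 0 ≤ P i j)
    (a : ℤ) (n : ℕ) (s : ℤ → α) : 0 ≤ chainWeight π P a n s :=
  mul_nonneg (hπ _) (Finset.prod_nonneg fun _ _ => hP0 _ _)

/-- The weight of a symmetric window, computed from its midpoint with the help of the reversed
chain. -/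
lemma chainWeight_window {α : Type*} {π : α → ℝ} {P : α → α → ℝ} (hπ : ∀ i, 0 < π i) (n : ℕ) (s : ℤ → α) :
    π (s 0) * ∏ i ∈ Finset.range n, (P (s i) (s (i + 1)) *
      (π (s (-i - 1)) * P (s (-i - 1)) (s (-i)) / π (s (-i)))) =
      chainWeight π P (-n) (2 * n) s := by
  induction n with
  | zero => simp [chainWeight]
  | succ n ih =>
    rw [Finset.prod_range_succ, ← mul_assoc, ih]
    simp only [chainWeight]
    have e : 2 * (n + 1) = 2 * n + 1 + 1 := by ring
    rw [e, Finset.prod_range_succ, Finset.prod_range_succ']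
    have h0 : π (s (-n)) ≠ 0 := (hπ _).ne'
    have e1 : -((n + 1 : ℕ) : ℤ) = -n - 1 := by push_cast; ring
    have e2 : ∀ i : ℕ, -(n : ℤ) - 1 + ((i + 1 : ℕ) : ℤ) = -n + i := by intro i; push_cast; ring
    have e3 : -(n : ℤ) + ((2 * n : ℕ) : ℤ) = n := by push_cast; ring
    have e4 : -(n : ℤ) - 1 + ((0 : ℕ) : ℤ) = -n - 1 := by simp
    have e5 : -(n : ℤ) - 1 + 1 = -n := by ring
    simp only [e1, e2, e3, e4, e5]
    field_simp

/-- The two-sided stationary Markov measure. -/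
lemma exists_markov_measure [MeasurableSpace α] [MeasurableSingletonClass α] {π : α → ℝ} {P : α → α → ℝ} (hπ : ∀ i, 0 < π i) (hπ1 : ∑ i, π i = 1)
    (hP0 : ∀ i j, 0 ≤ P i j) (hP1 : ∀ i, ∑ j, P i j = 1) (hstat : ∀ j, ∑ i, π i * P i j = π j) :
    ∃ μ : Measure (ℤ → α), IsProbabilityMeasure μ ∧ ∀ a n s,
      μ (agreeSet a n s) = ENNReal.ofReal (chainWeight π P a n s) := by
  obtain ⟨κ, hκ, hκP⟩ := exists_kernel_of_stochastic P hP0 hP1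
  -- The time-reversed chain, which is stochastic by stationarity. The future and the past of time
  -- zero run as independent chains from a common starting point, hence the diagonal initial law on
  -- pairs.
  obtain ⟨κ', hκ', hκP'⟩ := exists_kernel_of_stochastic (fun i j => π j * P j i / π i)
    (fun i j => div_nonneg (mul_nonneg (hπ j).le (hP0 j i)) (hπ i).le)
    (fun i => by rw [← Finset.sum_div, hstat, div_self (hπ i).ne'])
  have hsum : ∑ i, ENNReal.ofReal (π i) = 1 := by
    rw [← ENNReal.ofReal_sum_of_nonneg fun j _ => (hπ j).le, hπ1, ENNReal.ofReal_one]
  set μ₀ : Measure (α × α) := (PMF.ofFintype _ hsum).toMeasure.map (fun a => (a, a)) with hμ₀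
  have : IsProbabilityMeasure μ₀ := Measure.isProbabilityMeasure_map (by fun_prop)
  obtain ⟨T, hT, hTe⟩ := exists_chain μ₀ (Kernel.parallelComp κ κ')
  -- The first component supplies the times `i ≥ 0`, the second the times `i < 0`; at time zero the
  -- two agree almost surely.
  set f : (ℕ → α × α) → ℤ → α := fun η i => if 0 ≤ i then (η i.toNat).1 else (η (-i).toNat).2 with hf
  have hfm : Measurable f := by
    refine measurable_pi_lambda _ fun i => ?_
    by_cases hi : 0 ≤ i
    · simp only [hf, hi, if_true]; fun_prop
    · simp only [hf, hi, if_false]; fun_prop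
  set μ := T.map f with hμ
  have hμp : IsProbabilityMeasure μ := Measure.isProbabilityMeasure_map hfm.aemeasurable
  have hdiag : ∀ᵐ η ∂T, (η 0).1 = (η 0).2 := by
    have hsub : {η : ℕ → α × α | ¬ (η 0).1 = (η 0).2} ⊆
        ⋃ x : α × α, ⋃ _ : x.1 ≠ x.2, {η | ∀ i ≤ 0, η i = (fun _ => x) i} := by
      intro η hη
      simp only [Set.mem_iUnion]
      refine ⟨η 0, hη, fun i hi => ?_⟩
      rw [Nat.le_zero.1 hi]
    refine measure_mono_null hsub ?_
    rw [measure_iUnion_null_iff]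
    intro x
    rw [measure_iUnion_null_iff]
    intro hx
    rw [hTe 0 fun _ => x, hμ₀, Measure.map_apply (by fun_prop) (measurableSet_singleton _)]
    have : (fun a : α => (a, a)) ⁻¹' {x} = ∅ := by
      ext a
      simp only [Set.mem_preimage, Set.mem_singleton_iff, Set.mem_empty_iff_false, iff_false]
      rintro rfl
      exact hx rfl
    simp [this]
  have hsym : ∀ (n : ℕ) s, μ (agreeSet (-n) (2 * n) s) =
      ENNReal.ofReal (chainWeight π P (-n) (2 * n) s) := by
    intro n s
    rw [hμ, Measure.map_apply hfm (measurableSet_agreeSet _ _ _)]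
    have hset : T (f ⁻¹' agreeSet (-n) (2 * n) s) =
        T {η | ∀ i ≤ n, η i = (fun i : ℕ => (s i, s (-i))) i} := by
      refine measure_congr ?_
      filter_upwards [hdiag] with η hη
      refine propext ⟨fun h i hi => ?_, fun h i hi => ?_⟩
      · have h1 := h (n + i) (by omega)
        have h2 := h (n - i) (by omega)
        have e1 : -(n : ℤ) + ((n + i : ℕ) : ℤ) = i := by push_cast; ring
        have e2 : -(n : ℤ) + ((n - i : ℕ) : ℤ) = -i := by omega
        rw [e1] at h1
        rw [e2] at h2
        refine Prod.ext (by simpa [hf] using h1) ?_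
        rcases Nat.eq_zero_or_pos i with rfl | hpos
        · simpa [hf, hη] using h2
        · simpa [hf, hpos.ne'] using h2
      · by_cases hin : n ≤ i
        · obtain ⟨j, rfl⟩ := Nat.exists_eq_add_of_le hin
          have e1 : -(n : ℤ) + ((n + j : ℕ) : ℤ) = j := by push_cast; ring
          rw [e1]
          simpa [hf] using congrArg Prod.fst (h j (by omega))
        · obtain ⟨j, hj⟩ := Nat.exists_eq_add_of_le (show i ≤ n by omega)
          have e1 : -(n : ℤ) + (i : ℤ) = -j := by omega
          have hj0 : j ≠ 0 := by omega
          rw [e1]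
          simpa [hf, hj0] using congrArg Prod.snd (h j (by omega))
    rw [hset, hTe, ← chainWeight_window hπ, ENNReal.ofReal_mul (hπ _).le,
      ENNReal.ofReal_prod_of_nonneg fun i _ => mul_nonneg (hP0 _ _)
        (div_nonneg (mul_nonneg (hπ _).le (hP0 _ _)) (hπ _).le)]
    congr 1
    · rw [hμ₀, Measure.map_apply (by fun_prop) (measurableSet_singleton _)]
      have : (fun a : α => (a, a)) ⁻¹' {(s ((0 : ℕ) : ℤ), s (-((0 : ℕ) : ℤ)))} = {s 0} := by
        ext a
        simp
      rw [this, PMF.toMeasure_apply_singleton _ _ (measurableSet_singleton _)]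
      rfl
    · refine Finset.prod_congr rfl fun i _ => ?_
      rw [Kernel.parallelComp_apply, ← Set.singleton_prod_singleton, Measure.prod_prod, hκP, hκP',
        ← ENNReal.ofReal_mul (hP0 _ _)]
      have e1 : -(((i + 1 : ℕ)) : ℤ) = -i - 1 := by push_cast; ring
      simp only [e1]
      push_cast
      rfl
  have hall : ∀ b, ∀ ω : ℤ → α, ω b ∈ (Finset.univ : Finset α) := fun _ _ => Finset.mem_univ _
  have hcw := chainWeight_nonneg (fun i => (hπ i).le) hP0
  -- The formula is known for symmetric windows. Summing out letters at either end gives every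
  -- window inside one of these.
  have hright : ∀ (a : ℤ) (n : ℕ), (∀ s, μ (agreeSet a (n + 1) s) =
      ENNReal.ofReal (chainWeight π P a (n + 1) s)) → ∀ s, μ (agreeSet a n s) =
      ENNReal.ofReal (chainWeight π P a n s) := by
    intro a n h s
    rw [measure_eq_sum_fiber μ (measurable_pi_apply (a + n + 1)) Finset.univ
      (ae_of_all _ (hall _)), ← sum_chainWeight_update_right hP1,
      ENNReal.ofReal_sum_of_nonneg fun _ _ => hcw _ _ _]
    refine Finset.sum_congr rfl fun x _ => ?_
    rw [← h, agreeSet_update_right]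
  have hleft : ∀ (a : ℤ) (n : ℕ), (∀ s, μ (agreeSet a (n + 1) s) =
      ENNReal.ofReal (chainWeight π P a (n + 1) s)) → ∀ s, μ (agreeSet (a + 1) n s) =
      ENNReal.ofReal (chainWeight π P (a + 1) n s) := by
    intro a n h s
    rw [measure_eq_sum_fiber μ (measurable_pi_apply a) Finset.univ
      (ae_of_all _ (hall _)), ← sum_chainWeight_update_left hstat,
      ENNReal.ofReal_sum_of_nonneg fun _ _ => hcw _ _ _]
    refine Finset.sum_congr rfl fun x _ => ?_
    rw [← h, agreeSet_update_left]
  have hright' : ∀ (j : ℕ) (a : ℤ) (n : ℕ), (∀ s, μ (agreeSet a (n + j) s) =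
      ENNReal.ofReal (chainWeight π P a (n + j) s)) → ∀ s, μ (agreeSet a n s) =
      ENNReal.ofReal (chainWeight π P a n s) := by
    intro j
    induction j with
    | zero => exact fun a n h => h
    | succ j ih => exact fun a n h => ih a n (hright a (n + j) h)
  have hleft' : ∀ (j : ℕ) (a : ℤ) (n : ℕ), (∀ s, μ (agreeSet a (n + j) s) =
      ENNReal.ofReal (chainWeight π P a (n + j) s)) → ∀ s, μ (agreeSet (a + j) n s) =
      ENNReal.ofReal (chainWeight π P (a + j) n s) := by
    intro j
    induction j with
    | zero => intro a n h; simpa using h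
    | succ j ih =>
      intro a n h
      have := ih (a + 1) n (hleft a (n + j) h)
      have e : a + ((j + 1 : ℕ) : ℤ) = a + 1 + j := by push_cast; ring
      rwa [e]
  refine ⟨μ, hμp, fun a n => ?_⟩
  set N := a.natAbs + n with hN
  obtain ⟨j, hj⟩ : ∃ j : ℕ, a = -(N : ℤ) + j := ⟨(a + N).toNat, by omega⟩
  obtain ⟨l, hl⟩ : ∃ l : ℕ, 2 * N = n + j + l := ⟨2 * N - (n + j), by omega⟩
  have h1 := hsym N
  rw [hl] at h1
  have h2 := hleft' j _ n (hright' l _ _ h1)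
  rwa [← hj] at h2

end MarkovMeasure

/-! ### Cylinders determine the measure -/

section Ext

lemma agreeSet_eq_cylinder {V : Type*} (a : ℤ) (n : ℕ) (s : ℤ → V) :
    agreeSet a n s = cylinder a (fun i : Fin (n + 1) => s (a + (i : ℕ))) := by
  ext ω
  exact ⟨fun h i => h i (Nat.lt_succ_iff.1 i.2), fun h i hi => h ⟨i, Nat.lt_succ_iff.2 hi⟩⟩

/-- A measure on the space of two-sided sequences is determined by its values on cylinders. -/
lemma ext_of_agreeSet {V : Type*} [Countable V] [MeasurableSpace V] [MeasurableSingletonClass V]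
    {μ ν : Measure (ℤ → V)} [IsProbabilityMeasure μ] [IsProbabilityMeasure ν]
    (h : ∀ a n s, μ (agreeSet a n s) = ν (agreeSet a n s)) : μ = ν := by
  have hmem : ∀ (n : ℕ) (s ω : ℤ → V), ω ∈ agreeSet (-n) (2 * n) s ↔
      ∀ i : ℤ, -n ≤ i → i ≤ n → ω i = s i := by
    intro n s ω
    constructor
    · intro h i h1 h2
      have := h (i + n).toNat (by omega)
      have e : -(n : ℤ) + ((i + n).toNat : ℤ) = i := by omega
      rwa [e] at this
    · intro h i hi
      exact h _ (by omega) (by omega)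
  -- Symmetric windows are convenient as a π-system: two of them that meet are nested.
  refine ext_of_generate_finite {A | ∃ (n : ℕ) (s : ℤ → V), A = agreeSet (-n) (2 * n) s} ?_ ?_ ?_ ?_
  · refine le_antisymm ?_ (MeasurableSpace.generateFrom_le ?_)
    · refine iSup_le fun i => ?_
      rw [← measurable_iff_comap_le]
      refine @measurable_to_countable' _ _ _ _ (_) _ fun x => ?_
      have hset : (fun ω : ℤ → V => ω i) ⁻¹' {x} =
          ⋃ t : {t : Finset.Icc (-(i.natAbs : ℤ)) i.natAbs → V //
            t ⟨i, Finset.mem_Icc.2 ⟨by omega, by omega⟩⟩ = x},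
            agreeSet (-i.natAbs) (2 * i.natAbs)
              (fun j => if hj : j ∈ Finset.Icc (-(i.natAbs : ℤ)) i.natAbs then t.1 ⟨j, hj⟩
                else x) := by
        ext ω
        simp only [Set.mem_preimage, Set.mem_singleton_iff, Set.mem_iUnion, hmem]
        constructor
        · intro hω
          refine ⟨⟨fun j => ω j, hω⟩, fun j h1 h2 => ?_⟩
          rw [dif_pos (Finset.mem_Icc.2 ⟨h1, h2⟩)]
        · rintro ⟨⟨t, ht⟩, h⟩
          rw [h i (by omega) (by omega), dif_pos (Finset.mem_Icc.2 ⟨by omega, by omega⟩)]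
          exact ht
      rw [hset]
      exact MeasurableSet.iUnion fun t => MeasurableSpace.measurableSet_generateFrom ⟨_, _, rfl⟩
    · rintro _ ⟨n, s, rfl⟩
      exact measurableSet_agreeSet _ _ _
  · have key : ∀ (n m : ℕ), n ≤ m → ∀ s t : ℤ → V,
        (agreeSet (-n) (2 * n) s ∩ agreeSet (-m) (2 * m) t).Nonempty →
        agreeSet (-n) (2 * n) s ∩ agreeSet (-m) (2 * m) t = agreeSet (-m) (2 * m) t := by
      rintro n m hnm s t ⟨ω, hω1, hω2⟩
      refine Set.inter_eq_right.2 fun ω' hω' => ?_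
      rw [hmem] at *
      intro i h1 h2
      rw [hω' i (by omega) (by omega), ← hω2 i (by omega) (by omega), hω1 i h1 h2]
    rintro _ ⟨n, s, rfl⟩ _ ⟨m, t, rfl⟩ hne
    rcases le_total n m with hnm | hnm
    · exact ⟨m, t, key n m hnm s t hne⟩
    · rw [Set.inter_comm] at hne ⊢
      exact ⟨n, s, key m n hnm t s hne⟩
  · rintro _ ⟨n, s, rfl⟩
    exact h _ _ _
  · simp

end Ext

/-! ### Equilibrium measures of a finite graph -/

section Invariant

variable {H : DiGraph ℕ} {W : ℕ → ℕ → ℝ} {ν : Measure (ℤ → ℕ)}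

lemma measurableSet_cylinder {V : Type*} [MeasurableSpace V] [MeasurableSingletonClass V]
    {n : ℕ} (a : ℤ) (w : Fin n → V) : MeasurableSet (cylinder a w) := by
  have : cylinder a w = ⋂ i : Fin n, (fun ω : ℤ → V => ω (a + (i : ℕ))) ⁻¹' {w i} := by
    ext ω
    simp [cylinder]
  rw [this]
  exact MeasurableSet.iInter fun i => (measurable_pi_apply _) (measurableSet_singleton _)

lemma measurable_shift {V : Type*} [MeasurableSpace V] : Measurable (shift : (ℤ → V) → ℤ → V) :=
  measurable_pi_lambda _ fun _ => measurable_pi_apply _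

lemma preimage_shift_agreeSet {V : Type*} (a : ℤ) (n : ℕ) (s : ℤ → V) :
    shift ⁻¹' agreeSet a n (fun i => s (i + 1)) = agreeSet (a + 1) n s := by
  ext ω
  simp only [agreeSet, shift, Set.mem_preimage, Set.mem_ofPred_eq]
  simp only [add_right_comm]

lemma measure_agreeSet_shift {V : Type*} [MeasurableSpace V] [MeasurableSingletonClass V]
    {ν : Measure (ℤ → V)} (hν : ν.map shift = ν) (a : ℤ) (n : ℕ) (s : ℤ → V) :
    ν (agreeSet a n (fun i => s (i + 1))) = ν (agreeSet (a + 1) n s) := by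
  conv_lhs => rw [← hν]
  rw [Measure.map_apply measurable_shift (measurableSet_agreeSet _ _ _), preimage_shift_agreeSet]

lemma measure_agreeSet_eq_start_zero {V : Type*} [MeasurableSpace V] [MeasurableSingletonClass V]
    {ν : Measure (ℤ → V)} (hν : ν.map shift = ν) (a : ℤ) (n : ℕ) (s : ℤ → V) :
    ν (agreeSet a n s) = ν (agreeSet 0 n (fun i => s (i + a))) := by
  induction a generalizing s with
  | zero => simp
  | succ a ih =>
    rw [← measure_agreeSet_shift hν, ih]
    have e : ∀ i : ℤ, i + a + 1 = i + (a + 1) := fun i => by ring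
    simp only [e]
  | pred a ih =>
    have h1 := measure_agreeSet_shift hν (-(a : ℤ) - 1) n (fun i => s (i - 1))
    simp only [add_sub_cancel_right, sub_add_cancel] at h1
    rw [h1, ih]
    have e : ∀ i : ℤ, i + -(a : ℤ) - 1 = i + (-(a : ℤ) - 1) := fun i => by ring
    simp only [e]

lemma ae_mem_verts (hν : ν ∈ invariantMeasures H) : ∀ᵐ ω ∂ν, ∀ i, ω i ∈ H.verts := by
  filter_upwards [hν.2.2] with ω hω i
  exact H.fst_mem (hω i)

/-- The finite-dimensional distributions of a measure carried by the vertices of `H`. -/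
noncomputable def blockLaw (H : DiGraph ℕ) (ν : Measure (ℤ → ℕ)) (n : ℕ) (w : Fin n → H.verts) :
    ℝ :=
  ν.real (cylinder 0 (fun i => (w i : ℕ)))

lemma measure_cylinder_eq_zero (hν : ν ∈ invariantMeasures H) {n : ℕ} {w : Fin n → ℕ} {i : Fin n}
    (hi : w i ∉ H.verts) : ν (cylinder 0 w) = 0 := by
  have h := ae_mem_verts hν
  rw [ae_iff] at h
  have hsub : cylinder 0 w ⊆ {ω | ¬ ∀ i, ω i ∈ H.verts} := fun ω hω hall => hi (hω i ▸ hall _)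
  exact measure_mono_null hsub h

lemma blockLaw_two_adj (hν : ν ∈ invariantMeasures H) {w : Fin 2 → H.verts}
    (hw : blockLaw H ν 2 w ≠ 0) : H.Adj (w 0) (w 1) := by
  by_contra hadj
  apply hw
  have h := hν.2.2
  rw [ae_iff] at h
  have hsub : cylinder 0 (fun i => (w i : ℕ)) ⊆ {ω | ¬ ω ∈ H.pathSpace} := by
    intro ω hω hpath
    have h0 : ω 0 = w 0 := hω 0
    have h1 : ω 1 = w 1 := hω 1
    apply hadj
    rw [← h0, ← h1]
    exact hpath 0
  rw [blockLaw, Measure.real, measure_mono_null hsub h, ENNReal.toReal_zero]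

/-- Invariance moves every window to the origin, and blocks that leave `H` have measure zero under
both measures. -/
lemma eq_of_blockLaw_eq {μ : Measure (ℤ → ℕ)} (hμ : μ ∈ invariantMeasures H)
    (hν : ν ∈ invariantMeasures H)
    (h : ∀ n (w : Fin (n + 1) → H.verts), blockLaw H ν (n + 1) w = blockLaw H μ (n + 1) w) :
    ν = μ := by
  have := hμ.1
  have := hν.1
  refine ext_of_agreeSet fun a n s => ?_
  rw [measure_agreeSet_eq_start_zero hμ.2.1, measure_agreeSet_eq_start_zero hν.2.1,
    agreeSet_eq_cylinder]
  set w : Fin (n + 1) → ℕ := fun i => s (0 + (i : ℕ) + a) with hw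
  by_cases hall : ∀ i, w i ∈ H.verts
  · have h1 := h n (fun i => ⟨w i, hall i⟩)
    exact (measureReal_eq_measureReal_iff).1 h1
  · push Not at hall
    obtain ⟨i, hi⟩ := hall
    rw [measure_cylinder_eq_zero hμ hi, measure_cylinder_eq_zero hν hi]

variable [Fintype H.verts]

lemma real_eq_sum_fiber [IsProbabilityMeasure ν] {f : (ℤ → ℕ) → ℕ} (hf : Measurable f)
    (hs : ∀ᵐ ω ∂ν, f ω ∈ H.verts) (A : Set (ℤ → ℕ)) :
    ν.real A = ∑ x : H.verts, ν.real (f ⁻¹' {(x : ℕ)} ∩ A) := by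
  rw [Measure.real, measure_eq_sum_fiber ν hf H.verts.toFinset (A := A) (by simpa using hs),
    ENNReal.toReal_sum fun _ _ => measure_ne_top _ _]
  exact Finset.sum_subtype _ (fun x => Set.mem_toFinset) _

lemma isBlockLaw (hν : ν ∈ invariantMeasures H) : IsBlockLaw (blockLaw H ν) := by
  have := hν.1
  have hmem := ae_mem_verts hν
  refine ⟨fun n w => measureReal_nonneg, fun w => ?_, fun n w => ?_, fun n w => ?_⟩
  · have : cylinder 0 (fun i => (w i : ℕ)) = (Set.univ : Set (ℤ → ℕ)) := by
      ext ω
      simp [cylinder]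
    rw [blockLaw, this, probReal_univ]
  · rw [blockLaw, real_eq_sum_fiber (H := H) (measurable_pi_apply (n : ℤ))
      (hmem.mono fun ω h => h _)]
    refine Finset.sum_congr rfl fun x _ => ?_
    rw [blockLaw]
    congr 1
    ext ω
    simp only [cylinder, Set.mem_ofPred_eq, Set.mem_inter_iff, Set.mem_preimage,
      Set.mem_singleton_iff, Fin.forall_fin_succ']
    simp [and_comm]
  · have h1 : blockLaw H ν n w = ν.real (shift ⁻¹' cylinder 0 (fun i => (w i : ℕ))) := by
      rw [blockLaw]
      conv_lhs => rw [← hν.2.1]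
      rw [map_measureReal_apply measurable_shift (measurableSet_cylinder _ _)]
    rw [h1, real_eq_sum_fiber (H := H) (measurable_pi_apply (0 : ℤ))
      (hmem.mono fun ω h => h _)]
    refine Finset.sum_congr rfl fun x _ => ?_
    rw [blockLaw]
    congr 1
    ext ω
    simp only [cylinder, Set.mem_ofPred_eq, Set.mem_inter_iff, Set.mem_preimage, shift,
      Set.mem_singleton_iff, Fin.forall_fin_succ]
    simp

lemma blockEntropy_eq (hν : ν ∈ invariantMeasures H) (n : ℕ) :
    blockEntropy ν n = lawEntropy (blockLaw H ν) n := by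
  have hinj : Function.Injective fun (w : Fin n → H.verts) (i : Fin n) => (w i : ℕ) := by
    intro w w' h
    funext i
    exact Subtype.ext (congrFun h i)
  rw [blockEntropy, lawEntropy, ← tsum_fintype (L := SummationFilter.unconditional _)]
  refine (hinj.tsum_eq ?_).symm
  intro w hw
  have hall : ∀ i, w i ∈ H.verts := by
    intro i
    by_contra hi
    apply hw
    have h0 : ν.real (cylinder 0 w) = 0 := by
      rw [measureReal_def, measure_cylinder_eq_zero hν hi, ENNReal.toReal_zero]
    simp [h0]
  exact ⟨fun i => ⟨w i, hall i⟩, rfl⟩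

lemma integral_log_eq (hν : ν ∈ invariantMeasures H) :
    ∫ ω, Real.log (W (ω 0) (ω 1)) ∂ν =
      ∑ w : Fin 2 → H.verts, blockLaw H ν 2 w * Real.log (W (w 0) (w 1)) := by
  classical
  have := hν.1
  have hae : (fun ω : ℤ → ℕ => Real.log (W (ω 0) (ω 1))) =ᵐ[ν] fun ω =>
      ∑ w : Fin 2 → H.verts, (cylinder 0 (fun i => (w i : ℕ))).indicator
        (fun _ => Real.log (W (w 0) (w 1))) ω := by
    filter_upwards [ae_mem_verts hν] with ω hω
    rw [Finset.sum_eq_single (fun i : Fin 2 => (⟨ω (0 + (i : ℕ)), hω _⟩ : H.verts))]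
    · rw [Set.indicator_of_mem]
      · simp
      · exact fun i => rfl
    · intro w _ hw
      refine Set.indicator_of_notMem (fun h => hw ?_) _
      funext i
      exact Subtype.ext (h i).symm
    · exact fun h => absurd (Finset.mem_univ _) h
  rw [integral_congr_ae hae, integral_finsetSum]
  · refine Finset.sum_congr rfl fun w _ => ?_
    rw [integral_indicator_const _ (measurableSet_cylinder _ _), smul_eq_mul, blockLaw]
  · intro w _
    exact (integrable_const _).indicator (measurableSet_cylinder _ _)

/-- On edges, `log P` is `log r + log W` plus the difference of `log x` at the two ends, and the
mean of this difference vanishes by stationarity. Thus maximizing the pressure is maximizing entropy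
plus the mean of `log P`. -/
lemma pressure_eq (hν : ν ∈ invariantMeasures H) (hW : ∀ i j, H.Adj i j → 0 < W i j) {r : ℝ}
    (hr : 0 < r) {x : H.verts → ℝ} (hx : ∀ i, 0 < x i) {P : H.verts → H.verts → ℝ}
    (hP : ∀ i j : H.verts, H.Adj i j → P i j = r * W i j * x j / x i) :
    pressureFunctional W ν = limsup (fun n : ℕ => lawEntropy (blockLaw H ν) n / n) atTop
      + meanLog (blockLaw H ν) P - Real.log r := by
  have hlaw := isBlockLaw hν
  have hterm : ∀ w : Fin 2 → H.verts, blockLaw H ν 2 w * Real.log (P (w 0) (w 1)) =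
      blockLaw H ν 2 w * Real.log r + blockLaw H ν 2 w * Real.log (W (w 0) (w 1))
      + blockLaw H ν 2 w * Real.log (x (w 1)) - blockLaw H ν 2 w * Real.log (x (w 0)) := by
    intro w
    by_cases hw : blockLaw H ν 2 w = 0
    · simp [hw]
    · have hadj := blockLaw_two_adj hν hw
      rw [hP _ _ hadj, Real.log_div, Real.log_mul, Real.log_mul]
      · ring
      · exact hr.ne'
      · exact (hW _ _ hadj).ne'
      · exact mul_ne_zero hr.ne' (hW _ _ hadj).ne'
      · exact (hx _).ne'
      · exact mul_ne_zero (mul_ne_zero hr.ne' (hW _ _ hadj).ne') (hx _).ne'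
      · exact (hx _).ne'
  have hinit := hlaw.sum_mul_init (n := 1) fun w => Real.log (x (w 0))
  have htail := hlaw.sum_mul_tail (n := 1) fun w => Real.log (x (w 0))
  have e : ∑ w : Fin 2 → H.verts, blockLaw H ν 2 w * Real.log (x (w 1)) =
      ∑ w : Fin 2 → H.verts, blockLaw H ν 2 w * Real.log (x (w 0)) := htail.trans hinit.symm
  have hmean : meanLog (blockLaw H ν) P = Real.log r + ∫ ω, Real.log (W (ω 0) (ω 1)) ∂ν := by
    rw [meanLog, integral_log_eq hν]
    simp only [hterm, Finset.sum_add_distrib, Finset.sum_sub_distrib]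
    rw [e, ← Finset.sum_mul, hlaw.sum_eq_one]
    ring
  have hent : entropy ν = limsup (fun n : ℕ => lawEntropy (blockLaw H ν) n / n) atTop := by
    simp only [entropy, blockEntropy_eq hν]
  rw [pressureFunctional, hent, hmean]
  ring

/-- A sequence extending a block. -/
def extendBlock {V : Type*} {n : ℕ} (w : Fin (n + 1) → V) (j : ℤ) : V :=
  w ⟨min j.toNat n, by omega⟩

lemma cylinder_eq_agreeSet_extendBlock {V : Type*} {n : ℕ} (w : Fin (n + 1) → V) :
    cylinder 0 w = agreeSet 0 n (extendBlock w) := by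
  rw [agreeSet_eq_cylinder]
  congr 1
  funext i
  rw [extendBlock]
  congr 1
  ext
  simp
  omega

/-- The measure is built on sequences in the finite type `H.verts` and then pushed forward to
sequences of integers. -/
lemma exists_invariant_markov {π : H.verts → ℝ} {P : H.verts → H.verts → ℝ} (hπ : ∀ i, 0 < π i)
    (hπ1 : ∑ i, π i = 1) (hP0 : ∀ i j, 0 ≤ P i j) (hP1 : ∀ i, ∑ j, P i j = 1)
    (hstat : ∀ j, ∑ i, π i * P i j = π j) (hadj : ∀ i j : H.verts, ¬ H.Adj i j → P i j = 0) :
    ∃ μ ∈ invariantMeasures H, (∀ w, blockLaw H μ 1 w = π (w 0)) ∧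
      ∀ n (w : Fin (n + 2) → H.verts), blockLaw H μ (n + 2) w =
        blockLaw H μ (n + 1) (Fin.init w) * P (w (Fin.last n).castSucc) (w (Fin.last (n + 1))) := by
  obtain ⟨m, hm, hmw⟩ := exists_markov_measure hπ hπ1 hP0 hP1 hstat
  have hshift : m.map shift = m := by
    have : IsProbabilityMeasure (m.map shift) :=
      Measure.isProbabilityMeasure_map measurable_shift.aemeasurable
    refine ext_of_agreeSet fun a n s => ?_
    have e := preimage_shift_agreeSet a n fun j => s (j - 1)
    simp only [add_sub_cancel_right] at e
    rw [Measure.map_apply measurable_shift (measurableSet_agreeSet _ _ _), e, hmw, hmw]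
    congr 1
    rw [chainWeight, chainWeight]
    have e1 : ∀ i : ℕ, a + 1 + (i : ℤ) - 1 = a + i := fun i => by ring
    have e2 : ∀ i : ℕ, a + 1 + (i : ℤ) + 1 - 1 = a + i + 1 := fun i => by ring
    simp only [e1, e2, add_sub_cancel_right]
  set c : (ℤ → H.verts) → ℤ → ℕ := fun ω i => (ω i : ℕ) with hc
  have hcm : Measurable c :=
    measurable_pi_lambda _ fun i => measurable_subtype_coe.comp (measurable_pi_apply i)
  have hcA : ∀ a n (s : ℤ → H.verts), (m.map c) (agreeSet a n (fun i => (s i : ℕ))) =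
      ENNReal.ofReal (chainWeight π P a n s) := by
    intro a n s
    rw [Measure.map_apply hcm (measurableSet_agreeSet _ _ _), ← hmw]
    congr 1
    ext ω
    simp only [agreeSet, hc, Set.mem_preimage, Set.mem_ofPred_eq, Subtype.coe_inj]
  have hcw := chainWeight_nonneg (fun i => (hπ i).le) hP0
  have hblock : ∀ n (w : Fin (n + 1) → H.verts), blockLaw H (m.map c) (n + 1) w =
      chainWeight π P 0 n (extendBlock w) := by
    intro n w
    rw [blockLaw, cylinder_eq_agreeSet_extendBlock, Measure.real]
    exact (congrArg ENNReal.toReal (hcA 0 n (extendBlock w))).trans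
      (ENNReal.toReal_ofReal (hcw _ _ _))
  refine ⟨m.map c, ⟨Measure.isProbabilityMeasure_map hcm.aemeasurable, ?_, ?_⟩, fun w => ?_,
    fun n w => ?_⟩
  · rw [Measure.map_map measurable_shift hcm]
    have : shift ∘ c = c ∘ shift := rfl
    rw [this, ← Measure.map_map hcm measurable_shift, hshift]
  · have hall : ∀ i : ℤ, ∀ᵐ ω ∂m, H.Adj (ω i) (ω (i + 1)) := by
      intro i
      have hsub : {ω : ℤ → H.verts | ¬ H.Adj (ω i) (ω (i + 1))} ⊆
          ⋃ q : H.verts × H.verts, ⋃ _ : ¬ H.Adj q.1 q.2,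
            agreeSet i 1 (fun j => if j = i then q.1 else q.2) := by
        intro ω hω
        simp only [Set.mem_iUnion]
        refine ⟨(ω i, ω (i + 1)), hω, fun l hl => ?_⟩
        obtain rfl | rfl : l = 0 ∨ l = 1 := by omega
        · simp
        · simp
      refine measure_mono_null hsub ?_
      rw [measure_iUnion_null_iff]
      intro q
      rw [measure_iUnion_null_iff]
      intro hq
      rw [hmw, chainWeight]
      simp [hadj _ _ hq]
    have hpm : MeasurableSet H.pathSpace := by
      have : H.pathSpace = ⋂ i : ℤ, (fun ω : ℤ → ℕ => (ω i, ω (i + 1))) ⁻¹' {q | H.Adj q.1 q.2} := by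
        ext ω
        simp [DiGraph.pathSpace]
      rw [this]
      exact MeasurableSet.iInter fun i => Measurable.prodMk (measurable_pi_apply _)
        (measurable_pi_apply _) (Set.to_countable _).measurableSet
    refine (ae_map_iff hcm.aemeasurable hpm).2 ?_
    exact ae_all_iff.2 hall
  · rw [hblock, chainWeight]
    simp [extendBlock]
  · rw [hblock, hblock, chainWeight, chainWeight, Finset.prod_range_succ, ← mul_assoc]
    have e : ∀ j : ℤ, j ≤ n → extendBlock w j = extendBlock (Fin.init w) j := by
      intro j hj
      simp only [extendBlock, Fin.init]
      congr 1
      ext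
      simp only [Fin.val_castSucc]
      omega
    congr 1
    · rw [e _ (by omega)]
      congr 1
      refine Finset.prod_congr rfl fun i hi => ?_
      rw [Finset.mem_range] at hi
      rw [e _ (by omega), e _ (by omega)]
    · simp only [extendBlock]
      congr 2
      · ext
        simp
      · ext
        simp

/-- Existence and uniqueness of the equilibrium measure of a finite graph, given a positive right
eigenvector `x` of the weight matrix and the stationary distribution `π` of the associated Markov
chain. -/
theorem exists_unique_equilibriumMeasure (hW : ∀ i j, H.Adj i j → 0 < W i j) {r : ℝ}
    (hr : 0 < r) {x : H.verts → ℝ} (hx : ∀ i, 0 < x i) {P : H.verts → H.verts → ℝ}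
    (hP : ∀ i j : H.verts, H.Adj i j → P i j = r * W i j * x j / x i)
    (hadj : ∀ i j : H.verts, ¬ H.Adj i j → P i j = 0) (hP1 : ∀ i, ∑ j, P i j = 1)
    {π : H.verts → ℝ} (hπ : ∀ i, 0 < π i) (hπ1 : ∑ i, π i = 1)
    (hstat : ∀ j, ∑ i, π i * P i j = π j)
    (huniq : ∀ π' : H.verts → ℝ, ∑ i, π' i = 1 → (∀ j, ∑ i, π' i * P i j = π' j) → π' = π) :
    ∃ μ, IsEquilibriumMeasure H W μ ∧ (∀ ν, IsEquilibriumMeasure H W ν → ν = μ) ∧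
      ∀ i : H.verts, μ.real (cylinder 0 (fun _ : Fin 1 => (i : ℕ))) = π i := by
  have hPpos : ∀ i j : H.verts, H.Adj i j → 0 < P i j := by
    intro i j h
    rw [hP i j h]
    exact div_pos (mul_pos (mul_pos hr (hW _ _ h)) (hx j)) (hx i)
  have hP0 : ∀ i j, 0 ≤ P i j := by
    intro i j
    by_cases h : H.Adj i j
    · exact (hPpos i j h).le
    · exact (hadj i j h).ge
  obtain ⟨μ, hμ, hμ1, hμM⟩ := exists_invariant_markov hπ hπ1 hP0 hP1 hstat hadj
  have hpμ : pressureFunctional W μ = -Real.log r := by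
    rw [pressure_eq hμ hW hr hx hP, (isBlockLaw hμ).limsup_lawEntropy_of_markov hμM]
    ring
  have hsupp : ∀ ν ∈ invariantMeasures H, ∀ w : Fin 2 → H.verts, blockLaw H ν 2 w ≠ 0 →
      P (w 0) (w 1) ≠ 0 := fun ν hν w hw => (hPpos _ _ (blockLaw_two_adj hν hw)).ne'
  refine ⟨μ, ⟨hμ, fun ν hν => ?_⟩, fun ν hν => ?_, fun i => hμ1 fun _ => i⟩
  · have := (isBlockLaw hν).limsup_lawEntropy_le_neg_meanLog hP0 hP1 (hsupp ν hν)
    rw [hpμ, pressure_eq hν hW hr hx hP]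
    linarith
  · obtain ⟨hν, hmax⟩ := hν
    have hlaw := isBlockLaw hν
    have h1 := hmax μ hμ
    rw [hpμ, pressure_eq hν hW hr hx hP] at h1
    have hM := hlaw.eq_mul_of_le_limsup hP0 hP1 (hsupp ν hν) (by linarith)
    -- Maximality forces the Markov property with matrix `P`; the one-letter law is then stationary
    -- for `P`, hence equal to `π`, and it determines all blocks.
    have hone : (fun i => blockLaw H ν 1 fun _ => i) = π := by
      apply huniq
      · rw [← hlaw.sum_eq_one 1]
        exact (Equiv.funUnique (Fin 1) H.verts).symm.sum_comp fun w => blockLaw H ν 1 w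
      · intro j
        rw [← hlaw.sum_cons 1 fun _ => j]
        refine Finset.sum_congr rfl fun i _ => ?_
        rw [hM 0]
        have e : (Fin.init (Fin.cons i fun _ => j : Fin 2 → H.verts) : Fin 1 → H.verts) =
            fun _ => i := by
          funext l
          obtain rfl := Subsingleton.elim l 0
          rfl
        rw [e]
        rfl
    refine eq_of_blockLaw_eq hμ hν fun n => ?_
    induction n with
    | zero =>
      intro w
      rw [hμ1, ← hone]
      dsimp only
      congr 1
      funext i
      rw [Subsingleton.elim (α := Fin 1) i 0]
    | succ n ih =>
      intro w
      rw [hM, hμM, ih]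

end Invariant

/-! ### Row eigenvectors and the mean return time -/

section Eigenvectors

variable {V : Type*} {k : V → V → ℝ≥0∞} {o : V} {X Y : V → ℝ≥0∞}

/-- A row vector that is harmonic off `o` is harmonic, if there is a harmonic column vector. -/
lemma harmonic_of_harmonic_off (hX : ∀ i, ∑' j, k i j * X j = X i) (hXo : X o = 1)
    (hY : ∀ j, j ≠ o → ∑' i, Y i * k i j = Y j) (hfin : ∑' i, Y i * X i ≠ ∞) (j : V) :
    ∑' i, Y i * k i j = Y j := by
  classical
  by_cases hj : j = o
  · subst hj
    -- Pairing with the harmonic `X` gives `⟨Y, X⟩ = ⟨Y, k X⟩ = ⟨Y k, X⟩`. The terms off `o` agree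
    -- and have a finite sum, so they cancel and leave the equation at `o`.
    have h1 : ∑' i, Y i * X i = ∑' l, (∑' i, Y i * k i l) * X l := by
      calc ∑' i, Y i * X i = ∑' i, ∑' l, Y i * (k i l * X l) := by
            refine tsum_congr fun i => ?_
            rw [ENNReal.tsum_mul_left, hX]
        _ = ∑' l, ∑' i, Y i * (k i l * X l) := ENNReal.tsum_comm
        _ = _ := by
            refine tsum_congr fun l => ?_
            rw [← ENNReal.tsum_mul_right]
            exact tsum_congr fun i => by ring
    have h2 := ENNReal.summable.tsum_eq_add_tsum_ite' (f := fun i => Y i * X i) j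
    have h3 := ENNReal.summable.tsum_eq_add_tsum_ite' (f := fun l => (∑' i, Y i * k i l) * X l) j
    have h4 : ∀ l, (if l = j then 0 else (∑' i, Y i * k i l) * X l) =
        if l = j then 0 else Y l * X l := by
      intro l
      split_ifs with h
      · rfl
      · rw [hY l h]
    simp only [h4] at h3
    rw [← h1, h2, hXo, mul_one, mul_one] at h3
    have hne : ∑' l, (if l = j then 0 else Y l * X l) ≠ ∞ :=
      ne_top_of_le_ne_top hfin (ENNReal.tsum_le_tsum fun l => by split_ifs <;> simp)
    exact ((ENNReal.add_left_inj hne).1 h3).symm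
  · exact hY j hj

/-- The total weight of the simple cycles, counted with their length, is at least `L` times the
weight of the cycles of length at least `L`. -/
lemma mul_tail_le_tsum (hY : ∀ j, ∑' i, Y i * k i j = Y j) (hYo : Y o = 1) (L : ℕ) :
    ((L + 1 : ℕ) : ℝ≥0∞) * ∑' m, ∑' l, k o l * hitTerm k {o} 1 (m + L) l ≤
      ∑' i, Y i * hitSum k {o} 1 i := by
  classical
  -- `t n` is the weight of the first-hitting paths of length at least `n`, and `T n` that of the
  -- simple `o`-cycles of length greater than `n`. Applying `k` to `t n` gives `t (n + 1)`, except
  -- for the extra `T n` at `o`. Pairing with the invariant `Y` and telescoping shows that the sum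
  -- of the tails `T i` is at most `⟨Y, t 0⟩`.
  set t : ℕ → V → ℝ≥0∞ := fun n j => ∑' m, hitTerm k {o} 1 (m + n) j with ht
  set T : ℕ → ℝ≥0∞ := fun n => ∑' l, k o l * t n l with hT
  have hstep : ∀ n j, ∑' l, k j l * t n l = t (n + 1) j + if j = o then T n else 0 := by
    intro n j
    by_cases hj : j = o
    · subst hj
      simp [ht, hT, hitTerm]
    · simp only [hj, if_false, add_zero, ht, ← ENNReal.tsum_mul_left]
      rw [ENNReal.tsum_comm]
      refine tsum_congr fun m => ?_
      rw [← add_assoc, hitTerm, if_neg (by simpa using hj)]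
  have hrec : ∀ n, ∑' j, Y j * t n j = ∑' j, Y j * t (n + 1) j + T n := by
    intro n
    calc ∑' j, Y j * t n j = ∑' j, ∑' i, Y i * (k i j * t n j) := by
          refine tsum_congr fun j => ?_
          conv_lhs => rw [← hY j, ← ENNReal.tsum_mul_right]
          exact tsum_congr fun i => by ring
      _ = ∑' i, Y i * ∑' j, k i j * t n j := by
          rw [ENNReal.tsum_comm]
          simp only [ENNReal.tsum_mul_left]
      _ = ∑' i, (Y i * t (n + 1) i + if i = o then T n else 0) := by
          refine tsum_congr fun i => ?_
          rw [hstep, mul_add]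
          congr 1
          split_ifs with h
          · rw [h, hYo, one_mul]
          · simp
      _ = _ := by rw [ENNReal.tsum_add, tsum_ite_eq]
  have hmono : Antitone T := by
    refine antitone_nat_of_succ_le fun n => ?_
    refine ENNReal.tsum_le_tsum fun l => ?_
    gcongr
    have := ENNReal.tsum_comp_le_tsum_of_injective (add_left_injective 1)
      fun m => hitTerm k {o} 1 (m + n) l
    refine le_trans (le_of_eq ?_) this
    refine tsum_congr fun m => ?_
    congr 1
    omega
  have hsum : ∀ n, ∑ i ∈ Finset.range n, T i ≤ ∑' i, Y i * hitSum k {o} 1 i := by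
    intro n
    have h0 : ∀ n, ∑ i ∈ Finset.range n, T i + ∑' j, Y j * t n j = ∑' j, Y j * t 0 j := by
      intro n
      induction n with
      | zero => simp
      | succ n ih => rw [← ih, hrec n, Finset.sum_range_succ]; ring
    exact le_self_add.trans (h0 n).le
  calc ((L + 1 : ℕ) : ℝ≥0∞) * ∑' m, ∑' l, k o l * hitTerm k {o} 1 (m + L) l
      = ((L + 1 : ℕ) : ℝ≥0∞) * T L := by
        rw [ENNReal.tsum_comm]
        congr 1
        exact tsum_congr fun l => ENNReal.tsum_mul_left
    _ = ∑ _i ∈ Finset.range (L + 1), T L := by simp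
    _ ≤ ∑ i ∈ Finset.range (L + 1), T i := by
        refine Finset.sum_le_sum fun i hi => hmono ?_
        rw [Finset.mem_range] at hi
        omega
    _ ≤ _ := hsum _

end Eigenvectors

/-! ### Stationary distributions from eigenvectors -/

section StationaryDistribution

variable {α : Type*} [Fintype α] {K : α → α → ℝ} {rank : α → ℕ} {o : α} {x y : α → ℝ}

/-- If every edge that does not end in `o` increases the rank, a row eigenvector is determined by
its entry at `o`. -/
lemma eq_mul_of_rank (hK : ∀ i j, K i j ≠ 0 → j = o ∨ rank i < rank j) (hyo : y o = 1)
    (hy : ∀ j, ∑ i, y i * K i j = y j) {z : α → ℝ} (hz : ∀ j, ∑ i, z i * K i j = z j) (j : α) :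
    z j = z o * y j := by
  induction hn : rank j using Nat.strong_induction_on generalizing j with
  | _ n ih =>
    by_cases hj : j = o
    · rw [hj, hyo, mul_one]
    · rw [← hz j, ← hy j, Finset.mul_sum]
      refine Finset.sum_congr rfl fun i _ => ?_
      by_cases hij : K i j = 0
      · simp [hij]
      · rw [ih (rank i) (by have := (hK i j hij).resolve_left hj; omega) i rfl]
        ring

lemma stationary_of_eigenvectors (hx : ∀ i, 0 < x i) (hy : ∀ j, ∑ i, y i * K i j = y j) (j : α) :
    ∑ i, y i * x i / (∑ l, y l * x l) * (K i j * x j / x i) = y j * x j / ∑ l, y l * x l := by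
  rw [← hy j, Finset.sum_mul, Finset.sum_div]
  refine Finset.sum_congr rfl fun i _ => ?_
  have := (hx i).ne'
  field_simp

/-- Dividing a stationary vector by `x` gives a row eigenvector of `K`, hence a multiple of `y`;
normalization fixes the factor. -/
lemma stationary_unique (hK : ∀ i j, K i j ≠ 0 → j = o ∨ rank i < rank j) (hyo : y o = 1)
    (hy : ∀ j, ∑ i, y i * K i j = y j) (hx : ∀ i, 0 < x i) (hZ : ∑ l, y l * x l ≠ 0)
    {π : α → ℝ} (hπ1 : ∑ i, π i = 1) (hπ : ∀ j, ∑ i, π i * (K i j * x j / x i) = π j) :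
    π = fun i => y i * x i / ∑ l, y l * x l := by
  have hz : ∀ j, ∑ i, π i / x i * K i j = π j / x j := by
    intro j
    conv_rhs => rw [← hπ j]
    rw [Finset.sum_div]
    refine Finset.sum_congr rfl fun i _ => ?_
    have h1 := (hx i).ne'
    have h2 := (hx j).ne'
    field_simp
  have hmul := eq_mul_of_rank hK hyo hy hz
  have hπj : ∀ j, π j = π o / x o * (y j * x j) := by
    intro j
    have := hmul j
    rw [div_eq_iff (hx j).ne'] at this
    rw [this]
    ring
  have hc : π o / x o * ∑ l, y l * x l = 1 := by
    rw [← hπ1, Finset.mul_sum]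
    exact Finset.sum_congr rfl fun l _ => (hπj l).symm
  funext j
  rw [hπj j, eq_div_iff hZ]
  calc π o / x o * (y j * x j) * ∑ l, y l * x l
      = (π o / x o * ∑ l, y l * x l) * (y j * x j) := by ring
    _ = _ := by rw [hc, one_mul]

end StationaryDistribution

/-! ### The mass of the vertex 1 and of all cylinders -/

section FiniteGraph

open DiGraph

variable {H : DiGraph ℕ} {W : ℕ → ℕ → ℝ}

lemma tsum_eq_sum_verts [Fintype H.verts] {f : ℕ → ℝ≥0∞} (hf : ∀ i, i ∉ H.verts → f i = 0) :
    ∑' i, f i = ∑ i : H.verts, f i := by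
  rw [← tsum_fintype (L := SummationFilter.unconditional _)]
  refine (Subtype.val_injective.tsum_eq fun i hi => ?_).symm
  by_contra h
  exact hi (hf i fun hv => h ⟨⟨i, hv⟩, rfl⟩)

/-- The equilibrium measure of a finite connected graph in which the vertices increase along paths
until they return to `1`, and the bound for the measure of the vertex `1` by the lengths of the
simple `1`-cycles. -/
theorem exists_equilibriumMeasure_vertex_le (hfin : H.verts.Finite) (hconn : H.IsConnected)
    (h1 : 1 ∈ H.verts) (hinc : ∀ i j, H.Adj i j → j = 1 ∨ i < j)
    (hW : ∀ i j, H.Adj i j → 0 < W i j) {r : ℝ≥0} (hr : r ≠ 0) (hgen : H.genFun W 1 r = 1)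
    {c : ℝ≥0} {L : ℕ} (hc : c ≠ 0)
    (hL : (c : ℝ≥0∞) ≤ L * ∑' l, H.cycleSum W 1 (l + L) * (r : ℝ≥0∞) ^ (l + L)) :
    ∃ μ, IsEquilibriumMeasure H W μ ∧ (∀ ν, IsEquilibriumMeasure H W ν → ν = μ) ∧
      μ.real (cylinder 0 (fun _ : Fin 1 => 1)) ≤ (c : ℝ)⁻¹ := by
  classical
  have : Fintype H.verts := hfin.fintype
  set k : ℕ → ℕ → ℝ≥0∞ := fun i j => r * H.edgeWeight W i j with hk
  have hk0 : ∀ {i j}, H.Adj i j → k i j ≠ 0 := by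
    intro i j h
    simp [hk, edgeWeight, h, hr, hW i j h]
  have hkn : ∀ {i j}, ¬ H.Adj i j → k i j = 0 := by
    intro i j h
    simp [hk, edgeWeight, h]
  have hktop : ∀ i j, k i j ≠ ∞ := by
    intro i j
    by_cases h : H.Adj i j <;> simp [hk, edgeWeight, h, ENNReal.mul_eq_top]
  have hkr : ∀ {i j}, H.Adj i j → (k i j).toReal = r * W i j := by
    intro i j h
    simp [hk, edgeWeight, h, (hW i j h).le]
  -- the column eigenvector
  set X := hitSum k {1} 1 with hXdef
  have hX1 : X 1 = 1 := hitSum_of_mem (Set.mem_singleton 1)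
  have hret : returnSum k 1 = 1 := by rw [← hgen, genFun_eq_returnSum hW]
  have hX : ∀ i, ∑' j, k i j * X j = X i := by
    intro i
    by_cases hi : i = 1
    · subst hi
      rw [hX1, ← hret]
      rfl
    · exact (hitSum_of_notMem (by simpa using hi)).symm
  have hXstep : ∀ {i j}, Relation.TransGen H.Adj i j → (X j ≠ 0 → X i ≠ 0) ∧ (X i ≠ ∞ → X j ≠ ∞) := by
    have hone : ∀ {i j}, H.Adj i j → (X j ≠ 0 → X i ≠ 0) ∧ (X i ≠ ∞ → X j ≠ ∞) := by
      intro i j h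
      have hle : k i j * X j ≤ X i := (ENNReal.le_tsum j).trans (hX i).le
      refine ⟨fun hj hi => ?_, fun hi => ne_top_of_mul_le (hk0 h) hi hle⟩
      rw [hi, nonpos_iff_eq_zero] at hle
      exact mul_ne_zero (hk0 h) hj hle
    intro i j h
    induction h with
    | single h => exact hone h
    | tail _ h ih => exact ⟨fun hj => ih.1 ((hone h).1 hj), fun hi => (hone h).2 (ih.2 hi)⟩
  have hX0 : ∀ i ∈ H.verts, X i ≠ 0 := fun i hi => (hXstep (hconn i hi 1 h1)).1 (by simp [hX1])
  have hXtop : ∀ i ∈ H.verts, X i ≠ ∞ := fun i hi => (hXstep (hconn 1 h1 i hi)).2 (by simp [hX1])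
  -- the row eigenvector
  set Y := hitSum (fun i j => k j i) {1} 1 with hYdef
  have hY1 : Y 1 = 1 := hitSum_of_mem (Set.mem_singleton 1)
  have hY' : ∀ j, j ≠ 1 → ∑' i, Y i * k i j = Y j := by
    intro j hj
    rw [hYdef, hitSum_of_notMem (j := j) (by simpa using hj)]
    exact tsum_congr fun i => mul_comm _ _
  have hYout : ∀ j, j ∉ H.verts → Y j = 0 := by
    intro j hj
    rw [← hY' j (by rintro rfl; exact hj h1), ENNReal.tsum_eq_zero]
    intro i
    rw [hkn fun h => hj (H.snd_mem h), mul_zero]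
  have hkout : ∀ i j, i ∉ H.verts → Y i * k i j = 0 := fun i j hi => by rw [hYout i hi, zero_mul]
  -- Only smaller vertices have edges into `j ≠ 1`, so finiteness follows by induction on the
  -- vertex.
  have hYtop : ∀ j, Y j ≠ ∞ := by
    intro j
    induction j using Nat.strong_induction_on with
    | _ j ih =>
      by_cases hj : j = 1
      · simp [hj, hY1]
      · rw [← hY' j hj, tsum_eq_sum_verts (H := H) fun i hi => hkout i j hi]
        refine ENNReal.sum_ne_top.2 fun i _ => ?_
        by_cases h : H.Adj i j
        · exact ENNReal.mul_ne_top (ih i ((hinc _ _ h).resolve_left hj)) (hktop _ _)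
        · rw [hkn h, mul_zero]
          exact ENNReal.zero_ne_top
  have hS : ∑' i, Y i * X i = ∑ i : H.verts, Y i * X i :=
    tsum_eq_sum_verts fun i hi => by rw [hYout i hi, zero_mul]
  have hS_fin : ∑' i, Y i * X i ≠ ∞ := by
    rw [hS]
    exact ENNReal.sum_ne_top.2 fun i _ => ENNReal.mul_ne_top (hYtop _) (hXtop _ i.2)
  -- The normalization `Φ_H(r) = 1` enters through `X`, which it makes harmonic also at 1.
  have hY := harmonic_of_harmonic_off hX hX1 hY' hS_fin
  have hY0 : ∀ j ∈ H.verts, Y j ≠ 0 := by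
    intro j hj
    have hpath := hconn 1 h1 j hj
    have hone : ∀ {i j}, H.Adj i j → Y i ≠ 0 → Y j ≠ 0 := by
      intro i j h hi hj
      have hle : Y i * k i j ≤ Y j := (ENNReal.le_tsum i).trans (hY j).le
      rw [hj, nonpos_iff_eq_zero] at hle
      exact mul_ne_zero hi (hk0 h) hle
    clear hj
    induction hpath with
    | single h => exact hone h (by simp [hY1])
    | tail _ h ih => exact hone h ih
  have hbound : (c : ℝ≥0∞) ≤ ∑' i, Y i * X i := by
    -- The case `L = 0` contradicts `c ≠ 0`. Otherwise the first edge of each cycle accounts for the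
    -- shift from `L + 1` to `L` in `hitTerm`.
    rcases L with _ | L
    · rw [Nat.cast_zero, zero_mul] at hL
      exact absurd (nonpos_iff_eq_zero.1 hL) (by simpa using hc)
    · refine hL.trans (le_trans (le_of_eq ?_) (mul_tail_le_tsum hY hY1 L))
      congr 1
      refine tsum_congr fun l => ?_
      rw [← add_assoc, cycleSum_succ hW, ← ENNReal.tsum_mul_right]
      refine tsum_congr fun j => ?_
      rw [hk, hitTerm_scale]
      ring
  -- real versions
  set x : H.verts → ℝ := fun i => (X i).toReal with hx
  set y : H.verts → ℝ := fun i => (Y i).toReal with hy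
  set K : H.verts → H.verts → ℝ := fun i j => (k i j).toReal with hK
  set o : H.verts := ⟨1, h1⟩ with ho
  have hxpos : ∀ i, 0 < x i := fun i => ENNReal.toReal_pos (hX0 i i.2) (hXtop i i.2)
  have hypos : ∀ i, 0 < y i := fun i => ENNReal.toReal_pos (hY0 i i.2) (hYtop i)
  have hxo : x o = 1 := by simp [hx, ho, hX1]
  have hyo : y o = 1 := by simp [hy, ho, hY1]
  have hKx : ∀ i, ∑ j, K i j * x j = x i := by
    intro i
    rw [hx]
    dsimp only
    rw [← hX i, tsum_eq_sum_verts (H := H) fun j hj => by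
        rw [hkn fun h => hj (H.snd_mem h), zero_mul],
      ENNReal.toReal_sum fun j _ => ENNReal.mul_ne_top (hktop _ _) (hXtop _ j.2)]
    exact Finset.sum_congr rfl fun j _ => ENNReal.toReal_mul.symm
  have hyK : ∀ j, ∑ i, y i * K i j = y j := by
    intro j
    rw [hy]
    dsimp only
    rw [← hY j, tsum_eq_sum_verts (H := H) fun i hi => hkout i j hi,
      ENNReal.toReal_sum fun i _ => ENNReal.mul_ne_top (hYtop _) (hktop _ _)]
    exact Finset.sum_congr rfl fun i _ => ENNReal.toReal_mul.symm
  set Z := ∑ l, y l * x l with hZ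
  have hZc : (c : ℝ) ≤ Z := by
    have h2 : (∑' i, Y i * X i).toReal = Z := by
      rw [hS, ENNReal.toReal_sum fun i _ => ENNReal.mul_ne_top (hYtop _) (hXtop _ i.2)]
      exact Finset.sum_congr rfl fun i _ => ENNReal.toReal_mul
    rw [← h2]
    exact (ENNReal.toReal_le_toReal (by simp) hS_fin).2 hbound
  have hcpos : (0 : ℝ) < c := by
    have : 0 < c := pos_iff_ne_zero.2 hc
    exact_mod_cast this
  have hZpos : 0 < Z := hcpos.trans_le hZc
  have hKadj : ∀ i j : H.verts, K i j ≠ 0 → j = o ∨ (i : ℕ) < j := by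
    intro i j h
    have hadj : H.Adj i j := by
      by_contra hna
      exact h (by simp [hK, hkn hna])
    exact (hinc _ _ hadj).imp (fun h => Subtype.ext h) id
  obtain ⟨μ, hμ, huniq, hval⟩ := exists_unique_equilibriumMeasure (H := H) (W := W) hW
    (r := r) (by exact_mod_cast pos_iff_ne_zero.2 hr) (x := x) hxpos
    (P := fun i j => K i j * x j / x i)
    (fun i j h => by simp only [hK, hkr h])
    (fun i j h => by simp [hK, hkn h])
    (fun i => by rw [← Finset.sum_div, hKx, div_self (hxpos i).ne'])
    (π := fun i => y i * x i / Z)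
    (fun i => div_pos (mul_pos (hypos i) (hxpos i)) hZpos)
    (by rw [← Finset.sum_div, ← hZ, div_self hZpos.ne'])
    (fun j => stationary_of_eigenvectors hxpos hyK j)
    (fun π' h2 h3 => stationary_unique (rank := fun i : H.verts => (i : ℕ)) hKadj hyo hyK hxpos
      hZpos.ne' h2 h3)
  refine ⟨μ, hμ, huniq, ?_⟩
  have hv := hval o
  rw [hyo, hxo] at hv
  refine (le_of_eq hv).trans ?_
  rw [one_mul, one_div]
  exact inv_anti₀ hcpos hZc

/-- In a graph in which the vertices increase along paths until they return to `1`, an invariant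
measure of the vertex `u` is at most `u` times the measure of the vertex `1`. -/
lemma measure_cylinder_le {μ : Measure (ℤ → ℕ)} (hμ : μ ∈ invariantMeasures H)
    (hpos : ∀ i ∈ H.verts, 1 ≤ i) (hinc : ∀ i j, H.Adj i j → j = 1 ∨ i < j) {n : ℕ} (a : ℤ)
    (w : Fin (n + 1) → ℕ) :
    μ (cylinder a w) ≤ (w 0 : ℝ≥0∞) * μ (cylinder 0 (fun _ : Fin 1 => 1)) := by
  have hvert : ∀ (b : ℤ) (u : ℕ), μ {ω | ω b = u} = μ (cylinder 0 (fun _ : Fin 1 => u)) := by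
    intro b u
    have h := measure_agreeSet_eq_start_zero hμ.2.1 b 0 (fun _ => u)
    rw [agreeSet_eq_cylinder 0] at h
    rw [← h]
    congr 1
    ext ω
    simp [agreeSet]
  -- Going back in time from the vertex `w 0`, the path descends by at least one per step as long as
  -- it has not met 1. Since vertices are positive, it meets 1 at one of the times `a - j` with `j <
  -- w 0`.
  have hsub : cylinder a w ∩ H.pathSpace ⊆
      ⋃ j ∈ Finset.range (w 0), {ω : ℤ → ℕ | ω (a - (j : ℕ)) = 1} := by
    rintro ω ⟨hω, hpath⟩
    have h0 : ω a = w 0 := by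
      have := hω 0
      simpa using this
    by_contra hcon
    simp only [Finset.mem_range, Set.mem_iUnion, Set.mem_ofPred_eq, not_exists] at hcon
    have hdec : ∀ j : ℕ, j ≤ w 0 → ω (a - j) + j ≤ w 0 := by
      intro j
      induction j with
      | zero => simp [h0]
      | succ j ih =>
        intro hj
        have h2 := ih (by omega)
        have h3 := hpath (a - (j + 1 : ℕ))
        have e : a - ((j + 1 : ℕ) : ℤ) + 1 = a - j := by push_cast; ring
        rw [e] at h3
        have := (hinc _ _ h3).resolve_left (hcon j (by omega))
        omega
    have h4 := hdec (w 0) le_rfl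
    have h5 := hpos _ (H.fst_mem (hpath (a - (w 0 : ℕ))))
    omega
  calc μ (cylinder a w) = μ (cylinder a w ∩ H.pathSpace) := by
        refine measure_congr ?_
        filter_upwards [hμ.2.2] with ω hω
        exact propext ⟨fun h => ⟨h, hω⟩, fun h => h.1⟩
    _ ≤ μ (⋃ j ∈ Finset.range (w 0), {ω : ℤ → ℕ | ω (a - (j : ℕ)) = 1}) := measure_mono hsub
    _ ≤ ∑ j ∈ Finset.range (w 0), μ {ω : ℤ → ℕ | ω (a - (j : ℕ)) = 1} :=
        measure_biUnion_finset_le _ _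
    _ = _ := by simp [hvert]

lemma exists_cycleSubgraph_equilibriumMeasure {G : LoadedGraph.DiGraph ℕ}
    (hG : LoadedGraph.IsLinear G) {W : ℕ → ℕ → ℝ} (hW : ∀ i j : ℕ, G.Adj i j → 0 < W i j)
    (hU : G.IsUnstablePositive W) {n : ℕ} (hn : 1 ≤ n) (k : ℕ) :
    ∃ m > n, ∃ μ, IsEquilibriumMeasure (G.cycleSubgraph 1 n m) W μ ∧
      (∀ ν, IsEquilibriumMeasure (G.cycleSubgraph 1 n m) W ν → ν = μ) ∧
      ∀ (l : ℕ) (a : ℤ) (w : Fin (l + 1) → ℕ),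
        μ (cylinder a w) ≤ (w 0 : ℝ≥0∞) * ENNReal.ofReal (1 / ((k : ℝ) + 1)) := by
  -- A mean return time of at least `k + 1` bounds the measure of the vertex 1 by `1 / (k + 1)`.
  obtain ⟨m, hm, r, hr, hgen, L, hL⟩ := hG.exists_long_cycles hW hU hn ((k : ℝ≥0) + 1)
  have hsub : ∀ i j, (G.cycleSubgraph 1 n m).Adj i j → G.Adj i j :=
    fun _ _ h => adj_of_cycleSubgraph h
  have hinc : ∀ i j, (G.cycleSubgraph 1 n m).Adj i j → j = 1 ∨ i < j := by
    intro i j h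
    by_cases hj : j = 1
    · exact Or.inl hj
    · exact Or.inr (hG.lt_of_adj (hsub i j h) hj)
  have h1 : 1 ∈ (G.cycleSubgraph 1 n m).verts :=
    ⟨⟨1, _⟩, ⟨hG.isSimpleCycle_straight le_rfl, Or.inl hn⟩, 0, rfl⟩
  have hpos : ∀ i ∈ (G.cycleSubgraph 1 n m).verts, 1 ≤ i := by
    intro i hi
    obtain ⟨j, hj, -⟩ := Relation.TransGen.head'_iff.1
      (isConnected_cycleSubgraph G 1 n m i hi 1 h1)
    exact hG.one_le (hsub i j hj)
  obtain ⟨μ, hμ, huniq, hle⟩ := exists_equilibriumMeasure_vertex_le (hG.finite_cycleSubgraph n m)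
    (isConnected_cycleSubgraph G 1 n m) h1 hinc (fun i j h => hW i j (hsub i j h)) hr hgen
    (by positivity) hL
  refine ⟨m, hm, μ, hμ, huniq, fun l a w => ?_⟩
  refine (measure_cylinder_le hμ.1 hpos hinc a w).trans ?_
  have := hμ.1.1
  gcongr
  rw [← ofReal_measureReal]
  refine ENNReal.ofReal_le_ofReal (hle.trans (le_of_eq ?_))
  push_cast
  rw [one_div]

end FiniteGraph

end LoadedGraph

theorem theorem1 (G : LoadedGraph.DiGraph ℕ) (hG : LoadedGraph.IsLinear G)
    (W : ℕ → ℕ → ℝ) (hW : ∀ i j : ℕ, G.Adj i j → 0 < W i j)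
    (hU : G.IsUnstablePositive W) :
    ∃ n : ℕ → ℕ, StrictMono n ∧ (∀ k, 1 ≤ n k) ∧
      LoadedGraph.IsIrregular G W (fun k => G.cycleSubgraph 1 (n k) (n (k + 1))) := by
  -- The condition `1 ≤ n` stands inside the existential so that the choice function is total; the
  -- recursion `n (k + 1) = f (n k) k` from `n 0 = 1` then preserves it.
  have hstep : ∀ n k : ℕ, ∃ m, 1 ≤ n → n < m ∧
      ∃ μ, LoadedGraph.IsEquilibriumMeasure (G.cycleSubgraph 1 n m) W μ ∧
      (∀ ν, LoadedGraph.IsEquilibriumMeasure (G.cycleSubgraph 1 n m) W ν → ν = μ) ∧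
      ∀ (l : ℕ) (a : ℤ) (w : Fin (l + 1) → ℕ),
        μ (LoadedGraph.cylinder a w) ≤ (w 0 : ℝ≥0∞) * ENNReal.ofReal (1 / ((k : ℝ) + 1)) := by
    intro n k
    by_cases hn : 1 ≤ n
    · obtain ⟨m, hm, h⟩ := LoadedGraph.exists_cycleSubgraph_equilibriumMeasure hG hW hU hn k
      exact ⟨m, fun _ => ⟨hm, h⟩⟩
    · exact ⟨0, fun h => absurd h hn⟩
  choose f hf using hstep
  set n : ℕ → ℕ := fun k => Nat.rec 1 (fun k m => f m k) k with hn
  have hn1 : ∀ k, 1 ≤ n k := by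
    intro k
    induction k with
    | zero => exact le_rfl
    | succ k ih => exact ih.trans (hf (n k) k ih).1.le
  have hmono : StrictMono n := strictMono_nat_of_lt_succ fun k => (hf (n k) k (hn1 k)).1
  have hμ := fun k => (hf (n k) k (hn1 k)).2
  choose μ hμ1 hμ2 hμ3 using hμ
  refine ⟨n, hmono, hn1, hG.isExhaustive_cycleSubgraph hmono,
    fun k => ⟨hG.finite_cycleSubgraph _ _, LoadedGraph.isConnected_cycleSubgraph G 1 _ _⟩, μ,
    fun k => ⟨hμ1 k, hμ2 k⟩, fun l a w => ?_⟩
  have hlim : Tendsto (fun k : ℕ => (w 0 : ℝ≥0∞) * ENNReal.ofReal (1 / ((k : ℝ) + 1))) atTop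
      (𝓝 ((w 0 : ℝ≥0∞) * ENNReal.ofReal 0)) :=
    ENNReal.Tendsto.const_mul
      (ENNReal.tendsto_ofReal tendsto_one_div_add_atTop_nhds_zero_nat)
      (Or.inr (ENNReal.natCast_ne_top _))
  rw [ENNReal.ofReal_zero, mul_zero] at hlim
  exact tendsto_of_tendsto_of_tendsto_of_le_of_le tendsto_const_nhds hlim (fun _ => zero_le)
    fun k => hμ3 k l a w
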